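/- For $n\ge 1$ let $NC(n)$ be the set of non-crossing partitions of $\{1,\dots,n\}$. For $\pi\in NC(n)$ let $P_\pi$ be the permutation of $\{1,\dots,n\}$ whose cycles are the blocks of $\pi$, each run through in increasing order, and let the Kreweras complement $K(\pi)\in NC(n)$ be the partition determined by $P_{K(\pi)}=P_\pi^{-1}P_{1_n}$, where $P_{1_n}$ is the cycle $1\mapsto 2\mapsto\cdots\mapsto n\mapsto 1$. Let $\mathcal Y^{(1)}=\mathbb C[Y_2,Y_3,\dots]$ be the commutative polynomial algebra, put $Y_1:=1$ and $Y_\pi:=\prod_{A\in\pi}Y_{|A|}$ (product over the blocks $A$ of $\pi$), and give $\mathcal Y^{(1)}$ the comultiplication and counit which are the unital algebra homomorphisms with $$\Delta(Y_n)=\sum_{\pi\in NC(n)}Y_\pi\otimes Y_{K(\pi)},\qquad \varepsilon(Y_n)=0\qquad(n\ge 2),$$ and the grading for which $Y_n$ is homogeneous of degree $n-1$. Let $\mathrm{Sym}$ be the algebra of symmetric functions over $\mathbb C$ in infinitely many variables, graded by degree, with the comultiplication which is the unital algebra homomorphism satisfying $\Delta(e_n)=\sum_{i=0}^n e_i\otimes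 e_{n-i}$ for the elementary symmetric functions $e_n$ ($n \geq 1$, $e_0=1$), and with the counit $\varepsilon(f)=$ constant term of $f$. **Theorem 7.5.** With these structures $\mathcal Y^{(1)}$ and $\mathrm{Sym}$ are graded Hopf algebras, and the unital algebra homomorphism $\Phi:\mathcal Y^{(1)}\to\mathrm{Sym}$ determined by $$\Phi(Y_n)=y_n:=\sum_{\pi\in NC(n-1)}\ \prod_{A\in\pi}e_{|A|}\qquad(n\ge 2)$$ is an isomorphism of graded Hopf algebras: $\Phi$ is bijective, it satisfies $\Delta_{\mathrm{Sym}}\circ\Phi=(\Phi\otimes\Phi)\circ\Delta_{\mathcal Y^{(1)}}$ and $\varepsilon_{\mathrm{Sym}}\circ\Phi=\varepsilon_{\mathcal Y^{(1)}}$, it commutes with the antipodes, and it maps the homogeneous subspace of degree $n$ of $\mathcal Y^{(1)}$ onto that of $\mathrm{Sym}$ for every $n\ge 0$. -/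

import Mathlib

open scoped TensorProduct

namespace SymmFun

open MvPowerSeries

theorem killCompl_eq_iff (f : MvPowerSeries ℕ ℂ) (σ : Equiv.Perm ℕ) :
    killCompl σ.toEmbedding f = f ↔ ∀ m : ℕ →₀ ℕ, coeff (m.mapDomain σ) f = coeff m f := by
  rw [MvPowerSeries.ext_iff]
  simp only [coeff_killCompl, Finsupp.embDomain_eq_mapDomain]
  rfl

theorem coeff_mul_eq_zero {f g : MvPowerSeries ℕ ℂ} {M N : ℕ}
    (hf : ∀ m : ℕ →₀ ℕ, M < m.degree → coeff m f = 0)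
    (hg : ∀ m : ℕ →₀ ℕ, N < m.degree → coeff m g = 0)
    (m : ℕ →₀ ℕ) (hm : M + N < m.degree) : coeff m (f * g) = 0 := by
  classical
  rw [coeff_mul]
  refine Finset.sum_eq_zero fun p hp => ?_
  rw [Finset.HasAntidiagonal.mem_antidiagonal] at hp
  have hd : p.1.degree + p.2.degree = m.degree := by rw [← hp, map_add]
  by_cases h : M < p.1.degree
  · rw [hf _ h, zero_mul]
  · rw [hg _ (by omega), mul_zero]

end SymmFun

/-- The algebra of symmetric functions over `ℂ`: formal power series of bounded degree in the
variables `x₀, x₁, x₂, …` which are invariant under permutations of the variables. -/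
noncomputable def SymmFun : Subalgebra ℂ (MvPowerSeries ℕ ℂ) where
  carrier := {f | (∃ N : ℕ, ∀ m : ℕ →₀ ℕ, N < m.degree → MvPowerSeries.coeff m f = 0) ∧
    ∀ (σ : Equiv.Perm ℕ) (m : ℕ →₀ ℕ),
      MvPowerSeries.coeff (m.mapDomain σ) f = MvPowerSeries.coeff m f}
  mul_mem' := by
    rintro f g ⟨⟨M, hM⟩, hf⟩ ⟨⟨N, hN⟩, hg⟩
    refine ⟨⟨M + N, SymmFun.coeff_mul_eq_zero hM hN⟩, fun σ => ?_⟩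
    rw [← SymmFun.killCompl_eq_iff, map_mul, (SymmFun.killCompl_eq_iff f σ).2 (hf σ),
      (SymmFun.killCompl_eq_iff g σ).2 (hg σ)]
  add_mem' := by
    rintro f g ⟨⟨M, hM⟩, hf⟩ ⟨⟨N, hN⟩, hg⟩
    refine ⟨⟨M + N, fun m hm => ?_⟩, fun σ m => ?_⟩
    · rw [map_add, hM m (by omega), hN m (by omega), add_zero]
    · rw [map_add, map_add, hf, hg]
  algebraMap_mem' := by
    intro r
    refine ⟨⟨0, fun m hm => ?_⟩, fun σ => ?_⟩
    · rw [MvPowerSeries.algebraMap_apply]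
      refine MvPowerSeries.coeff_C_of_ne_zero (fun h => ?_) _
      rw [h, map_zero] at hm
      exact lt_irrefl _ hm
    · rw [← SymmFun.killCompl_eq_iff]
      exact AlgHom.commutes _ r

namespace SymmFun

open MvPowerSeries

open Classical in
/-- The sum of all squarefree monomials of degree `n`, as a formal power series. -/
noncomputable def eSeries (n : ℕ) : MvPowerSeries ℕ ℂ :=
  fun m => if (∀ i, m i ≤ 1) ∧ m.degree = n then 1 else 0

open Classical in
theorem coeff_eSeries (n : ℕ) (m : ℕ →₀ ℕ) :
    coeff m (eSeries n) = if (∀ i, m i ≤ 1) ∧ m.degree = n then 1 else 0 := rfl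

theorem eSeries_mem (n : ℕ) : eSeries n ∈ SymmFun := by
  classical
  refine ⟨⟨n, fun m hm => ?_⟩, fun σ m => ?_⟩
  · rw [coeff_eSeries, if_neg]
    rintro ⟨-, h⟩
    omega
  · rw [coeff_eSeries, coeff_eSeries]
    have h1 : (∀ i, (m.mapDomain σ) i ≤ 1) ↔ ∀ i, m i ≤ 1 := by
      rw [← σ.forall_congr_right]
      simp only [Finsupp.mapDomain_apply σ.injective]
    have h2 : (m.mapDomain σ).degree = m.degree := Finsupp.degree_mapDomain σ m
    simp only [h1, h2]

/-- The `n`-th elementary symmetric function; in particular `e 0 = 1`. -/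
noncomputable def e (n : ℕ) : SymmFun := ⟨eSeries n, eSeries_mem n⟩

open Classical in
theorem coeff_e (n : ℕ) (m : ℕ →₀ ℕ) :
    coeff m (e n : MvPowerSeries ℕ ℂ) = if (∀ i, m i ≤ 1) ∧ m.degree = n then 1 else 0 := rfl

theorem e_zero : e 0 = 1 := by
  classical
  refine Subtype.ext (MvPowerSeries.ext fun m => ?_)
  rw [coeff_e, OneMemClass.coe_one, coeff_one]
  refine if_congr ⟨fun h => (Finsupp.degree_eq_zero_iff m).1 h.2, ?_⟩ rfl rfl
  rintro rfl
  simp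

/-- Setting the variables `x_N, x_{N+1}, …` to `0`. -/
noncomputable def restr (N : ℕ) : SymmFun →ₐ[ℂ] MvPowerSeries (Fin N) ℂ :=
  (killCompl Fin.valEmbedding).comp SymmFun.val

theorem coeff_restr (N : ℕ) (f : SymmFun) (m : Fin N →₀ ℕ) :
    coeff m (restr N f) = coeff (m.mapDomain Fin.val) (f : MvPowerSeries ℕ ℂ) := by
  change coeff m (killCompl Fin.valEmbedding (f : MvPowerSeries ℕ ℂ)) = _
  rw [coeff_killCompl, Finsupp.embDomain_eq_mapDomain]
  rfl

theorem eq_zero_of_restr {N : ℕ} {f : SymmFun}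
    (hN : ∀ m : ℕ →₀ ℕ, N < m.degree → coeff m (f : MvPowerSeries ℕ ℂ) = 0)
    (h : restr N f = 0) : f = 0 := by
  refine Subtype.ext (MvPowerSeries.ext fun m => ?_)
  change coeff m (f : MvPowerSeries ℕ ℂ) = 0
  by_cases hm : N < m.degree
  · exact hN m hm
  have hc : m.support.card ≤ N := by
    refine le_trans ?_ (not_lt.1 hm)
    rw [Finsupp.degree_apply, Finset.card_eq_sum_ones]
    exact Finset.sum_le_sum fun i hi => Nat.one_le_iff_ne_zero.2 (Finsupp.mem_support_iff.1 hi)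
  obtain ⟨σ, hσ⟩ := (MulAction.isMultiplyPretransitive_iff (n := m.support.card)).1
    (Equiv.Perm.isMultiplyPretransitive ℕ m.support.card)
    (m.support.orderEmbOfFin rfl).toEmbedding Fin.valEmbedding
  have hlt : ∀ i ∈ m.support, σ i < N := by
    intro i hi
    have : i ∈ Set.range (m.support.orderEmbOfFin rfl) := by
      rw [Finset.range_orderEmbOfFin]
      exact hi
    obtain ⟨j, rfl⟩ := this
    have h2 : σ (m.support.orderEmbOfFin rfl j) = (j : ℕ) := DFunLike.congr_fun hσ j
    rw [h2]
    exact lt_of_lt_of_le j.2 hc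
  rw [← f.2.2 σ m]
  have : ∃ m' : Fin N →₀ ℕ, m'.mapDomain Fin.val = m.mapDomain σ := by
    have hr : ((m.mapDomain σ).support : Set ℕ) ⊆ Set.range (Fin.val : Fin N → ℕ) := by
      intro x hx
      have := Finsupp.mapDomain_support hx
      rw [Finset.mem_image] at this
      obtain ⟨i, hi, rfl⟩ := this
      exact ⟨⟨σ i, hlt i hi⟩, rfl⟩
    exact ⟨_, Finsupp.mapDomain_comapDomain _ Fin.val_injective _ hr⟩
  obtain ⟨m', hm'⟩ := this
  rw [← hm', ← coeff_restr, h]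
  rfl

theorem restr_e (N n : ℕ) :
    restr N (e n) = (MvPolynomial.esymm (Fin N) ℂ n : MvPowerSeries (Fin N) ℂ) := by
  classical
  ext m
  rw [coeff_restr, coeff_e, MvPolynomial.coeff_coe, MvPolynomial.esymm_eq_sum_monomial,
    MvPolynomial.coeff_sum]
  simp only [MvPolynomial.coeff_monomial]
  have key : ∀ t : Finset (Fin N), (∑ i ∈ t, Finsupp.single i 1 = m) ↔
      ((∀ i, m i ≤ 1) ∧ m.support = t) := by
    intro t
    have hs : ∀ i, (∑ j ∈ t, Finsupp.single j 1 : Fin N →₀ ℕ) i = if i ∈ t then 1 else 0 := by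
      intro i
      simp [Finsupp.finsetSum_apply, Finsupp.single_apply]
    constructor
    · rintro rfl
      refine ⟨fun i => ?_, ?_⟩
      · rw [hs]; split_ifs <;> simp
      · ext i; rw [Finsupp.mem_support_iff, hs]; simp
    · rintro ⟨h1, rfl⟩
      ext i
      rw [hs]
      have := h1 i
      by_cases hi : m i = 0
      · simp [hi]
      · rw [if_pos (Finsupp.mem_support_iff.2 hi)]; omega
  simp only [key]
  have hdeg : (m.mapDomain Fin.val).degree = m.degree := Finsupp.degree_mapDomain _ m
  have hle : (∀ i, (m.mapDomain Fin.val) i ≤ 1) ↔ ∀ i, m i ≤ 1 := by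
    constructor
    · intro h i
      simpa only [Finsupp.mapDomain_apply Fin.val_injective] using h i
    · intro h i
      by_cases hi : i ∈ Set.range (Fin.val : Fin N → ℕ)
      · obtain ⟨j, rfl⟩ := hi
        rw [Finsupp.mapDomain_apply Fin.val_injective]
        exact h j
      · rw [Finsupp.mapDomain_of_notMem_range _ _ hi]
        exact zero_le_one
  rw [hdeg, hle]
  by_cases h1 : ∀ i, m i ≤ 1
  · have hcard : m.support.card = m.degree := by
      rw [Finsupp.degree_apply, Finset.card_eq_sum_ones]
      refine Finset.sum_congr rfl fun i hi => ?_
      have := h1 i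
      have := Finsupp.mem_support_iff.1 hi
      omega
    simp only [h1, implies_true, true_and]
    rw [Finset.sum_ite_eq]
    simp [Finset.mem_powersetCard, hcard]
  · simp [h1]

/-- The algebra map sending the `i`-th variable to the elementary symmetric function `e (i+1)`. -/
noncomputable def ofE : MvPolynomial ℕ ℂ →ₐ[ℂ] SymmFun :=
  MvPolynomial.aeval fun i => e (i + 1)

theorem restr_ofE_rename (N : ℕ) (q : MvPolynomial (Fin N) ℂ) :
    restr N (ofE (MvPolynomial.rename Fin.val q)) =
      ((MvPolynomial.esymmAlgHom (Fin N) ℂ N q).1 : MvPowerSeries (Fin N) ℂ) := by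
  have h : ((restr N).comp (ofE.comp (MvPolynomial.rename Fin.val))) =
      (MvPolynomial.coeToMvPowerSeries.algHom ℂ).comp
        ((MvPolynomial.symmetricSubalgebra (Fin N) ℂ).val.comp
          (MvPolynomial.esymmAlgHom (Fin N) ℂ N)) := by
    refine MvPolynomial.algHom_ext fun i => ?_
    simp [ofE, restr_e, MvPolynomial.esymmAlgHom]
  have := DFunLike.congr_fun h q
  simpa using this

theorem ofE_injective : Function.Injective ofE := by
  rw [injective_iff_map_eq_zero]
  intro p hp
  obtain ⟨N, hN⟩ : ∃ N, N = p.vars.sup id + 1 := ⟨_, rfl⟩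
  obtain ⟨q, hq⟩ := MvPolynomial.exists_rename_eq_of_vars_subset_range p
    (Fin.val : Fin N → ℕ) Fin.val_injective (by
      intro i hi
      exact ⟨⟨i, hN ▸ Nat.lt_succ_of_le (Finset.le_sup (f := id) hi)⟩, rfl⟩)
  have h := restr_ofE_rename N q
  rw [hq, hp, map_zero, eq_comm, MvPolynomial.coe_eq_zero_iff] at h
  have h0 : MvPolynomial.esymmAlgHom (Fin N) ℂ N q = 0 := Subtype.ext h
  rw [← hq, (injective_iff_map_eq_zero _).1 (MvPolynomial.esymmAlgHom_injective ℂ (by simp)) q h0,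
    map_zero]

/-- The homogeneous symmetric functions of degree `n`. -/
noncomputable def grading (n : ℕ) : Submodule ℂ SymmFun where
  carrier := {f | ∀ m : ℕ →₀ ℕ, coeff m (f : MvPowerSeries ℕ ℂ) ≠ 0 → m.degree = n}
  zero_mem' := fun m hm => absurd (map_zero (coeff m)) hm
  add_mem' := by
    intro f g hf hg m hm
    by_contra h
    have h1 := not_not.1 (mt (hf m) h)
    have h2 := not_not.1 (mt (hg m) h)
    exact hm (by rw [AddMemClass.coe_add, map_add, h1, h2, add_zero])
  smul_mem' := by
    intro c f hf m hm
    refine hf m fun h => hm ?_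
    rw [SetLike.val_smul, coeff_smul, h, mul_zero]

theorem mem_grading {n : ℕ} {f : SymmFun} : f ∈ grading n ↔
    ∀ m : ℕ →₀ ℕ, coeff m (f : MvPowerSeries ℕ ℂ) ≠ 0 → m.degree = n := Iff.rfl

theorem e_mem_grading (n : ℕ) : e n ∈ grading n := by
  classical
  intro m hm
  rw [coeff_e] at hm
  by_contra h
  exact hm (if_neg fun h' => h h'.2)

instance : SetLike.GradedMonoid grading where
  one_mem := by
    rw [← e_zero]
    exact e_mem_grading 0
  mul_mem := by
    classical
    intro i j f g hf hg m hm
    rw [MulMemClass.coe_mul, coeff_mul] at hm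
    obtain ⟨p, hp, h⟩ := Finset.exists_ne_zero_of_sum_ne_zero hm
    rw [Finset.HasAntidiagonal.mem_antidiagonal] at hp
    rw [← hp, map_add, hf _ (left_ne_zero_of_mul h), hg _ (right_ne_zero_of_mul h)]

theorem ofE_monomial_mem (d : ℕ →₀ ℕ) (c : ℂ) :
    ofE (MvPolynomial.monomial d c) ∈ grading (Finsupp.weight (fun i : ℕ => i + 1) d) := by
  have h1 : ofE (MvPolynomial.monomial d 1) ∈
      grading (Finsupp.weight (fun i : ℕ => i + 1) d) := by
    induction d using Finsupp.induction_linear with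
    | zero =>
      rw [map_zero, MvPolynomial.monomial_zero', map_one, map_one]
      exact SetLike.GradedOne.one_mem
    | add d d' h h' =>
      rw [← one_mul (1 : ℂ), ← MvPolynomial.monomial_mul, map_mul, map_add]
      exact SetLike.mul_mem_graded h h'
    | single i k =>
      rw [← MvPolynomial.X_pow_eq_monomial, map_pow, Finsupp.weight_single, ofE,
        MvPolynomial.aeval_X]
      exact SetLike.pow_mem_graded k (e_mem_grading (i + 1))
  rw [← mul_one c, ← smul_eq_mul, ← MvPolynomial.smul_monomial, map_smul]
  exact Submodule.smul_mem _ _ h1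

theorem exists_restr_eq (f : SymmFun) (N : ℕ) :
    ∃ p : MvPolynomial ℕ ℂ, restr N (ofE p) = restr N f := by
  obtain ⟨K, hK⟩ := f.2.1
  have hb : ∀ m : Fin N →₀ ℕ, K < m.degree → coeff m (restr N f) = 0 := by
    intro m hm
    rw [coeff_restr]
    exact hK _ (by rwa [Finsupp.degree_mapDomain])
  obtain ⟨g, hg⟩ : ∃ g : MvPolynomial (Fin N) ℂ, (g : MvPowerSeries (Fin N) ℂ) = restr N f := by
    refine ⟨truncTotal (K + 1) (restr N f), MvPowerSeries.ext fun m => ?_⟩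
    rw [MvPolynomial.coeff_coe]
    by_cases hm : K < m.degree
    · rw [coeff_truncTotal_eq_zero _ hm, hb m hm]
    · rw [coeff_truncTotal _ (by omega)]
  have hsymm : g.IsSymmetric := by
    intro σ
    ext m
    obtain ⟨m', rfl⟩ : ∃ m', m = Finsupp.mapDomain σ m' :=
      ⟨m.mapDomain σ.symm, by
        rw [← Finsupp.mapDomain_comp, Equiv.self_comp_symm, Finsupp.mapDomain_id]⟩
    have hv : Fin.val ∘ σ = σ.viaEmbedding Fin.valEmbedding ∘ (Fin.val : Fin N → ℕ) :=
      funext fun i => (Equiv.Perm.viaEmbedding_apply σ Fin.valEmbedding i).symm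
    rw [MvPolynomial.coeff_rename_mapDomain _ σ.injective, ← MvPolynomial.coeff_coe,
      ← MvPolynomial.coeff_coe, hg, coeff_restr, coeff_restr, ← Finsupp.mapDomain_comp, hv,
      Finsupp.mapDomain_comp, f.2.2]
  obtain ⟨q, hq⟩ := (MvPolynomial.esymmAlgHom_fin_bijective ℂ N).2 ⟨g, hsymm⟩
  exact ⟨_, by rw [restr_ofE_rename, hq, hg]⟩

theorem ofE_surjective : Function.Surjective ofE := by
  intro f
  obtain ⟨N, hN⟩ := f.2.1
  obtain ⟨p, hp⟩ := exists_restr_eq f N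
  let w : (ℕ →₀ ℕ) →+ ℕ := Finsupp.weight (fun i : ℕ => i + 1)
  let t (d : ℕ →₀ ℕ) : SymmFun := ofE (MvPolynomial.monomial d (p.coeff d))
  have ht : ∀ d m, coeff m (t d : MvPowerSeries ℕ ℂ) ≠ 0 → m.degree = w d :=
    fun d => ofE_monomial_mem d _
  have hpt : ofE p = ∑ d ∈ p.support, t d := by
    conv_lhs => rw [p.as_sum]
    rw [map_sum]
  have hc : ∀ (s : Finset (ℕ →₀ ℕ)) (m : ℕ →₀ ℕ),
      coeff m ((∑ d ∈ s, t d : SymmFun) : MvPowerSeries ℕ ℂ) =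
        ∑ d ∈ s, coeff m (t d : MvPowerSeries ℕ ℂ) := by
    intro s m
    rw [show ((∑ d ∈ s, t d : SymmFun) : MvPowerSeries ℕ ℂ) = ∑ d ∈ s, (t d : MvPowerSeries ℕ ℂ) from
      map_sum SymmFun.val t s, map_sum]
  let p' : MvPolynomial ℕ ℂ := ∑ d ∈ p.support with w d ≤ N, MvPolynomial.monomial d (p.coeff d)
  have hpt' : ofE p' = ∑ d ∈ p.support with w d ≤ N, t d := map_sum _ _ _
  have hbig : ∀ m : ℕ →₀ ℕ, N < m.degree → coeff m (ofE p' : MvPowerSeries ℕ ℂ) = 0 := by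
    intro m hm
    rw [hpt', hc]
    refine Finset.sum_eq_zero fun d hd => ?_
    by_contra h
    have := ht d m h
    have := (Finset.mem_filter.1 hd).2
    omega
  have hsmall : ∀ m : ℕ →₀ ℕ, m.degree ≤ N →
      coeff m (ofE p' : MvPowerSeries ℕ ℂ) = coeff m (ofE p : MvPowerSeries ℕ ℂ) := by
    intro m hm
    rw [hpt', hpt, hc, hc]
    refine Finset.sum_subset (Finset.filter_subset _ _) fun d hd hd' => ?_
    by_contra h
    have := ht d m h
    exact hd' (Finset.mem_filter.2 ⟨hd, by omega⟩)
  refine ⟨p', sub_eq_zero.1 (eq_zero_of_restr (N := N) (fun m hm => ?_) ?_)⟩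
  · rw [AddSubgroupClass.coe_sub, map_sub, hbig m hm, hN m hm, sub_zero]
  · rw [map_sub, sub_eq_zero]
    ext m
    rw [coeff_restr]
    by_cases hm : N < (m.mapDomain Fin.val).degree
    · rw [hbig _ hm, coeff_restr, hN _ hm]
    · rw [hsmall _ (not_lt.1 hm), ← coeff_restr, hp]

/-- The fundamental theorem of symmetric functions: `SymmFun` is the polynomial algebra on the
elementary symmetric functions `e 1, e 2, e 3, …`. -/
noncomputable def equivE : MvPolynomial ℕ ℂ ≃ₐ[ℂ] SymmFun :=
  AlgEquiv.ofBijective ofE ⟨ofE_injective, ofE_surjective⟩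

theorem equivE_symm_e (i : ℕ) : equivE.symm (e (i + 1)) = MvPolynomial.X i := by
  rw [AlgEquiv.symm_apply_eq]
  exact (MvPolynomial.aeval_X (fun j => e (j + 1)) i).symm

/-- The comultiplication of the Hopf algebra of symmetric functions: the unital algebra
homomorphism determined by `Δ (e n) = ∑ e i ⊗ e (n - i)`, see `comul_e`. -/
noncomputable def comul : SymmFun →ₐ[ℂ] SymmFun ⊗[ℂ] SymmFun :=
  (MvPolynomial.aeval fun n => ∑ i ∈ Finset.range (n + 2), e i ⊗ₜ[ℂ] e (n + 1 - i)).comp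
    (equivE.symm : SymmFun →ₐ[ℂ] MvPolynomial ℕ ℂ)

theorem comul_e (n : ℕ) :
    comul (e n) = ∑ i ∈ Finset.range (n + 1), e i ⊗ₜ[ℂ] e (n - i) := by
  cases n with
  | zero =>
    rw [e_zero, map_one, Finset.sum_range_one, e_zero]
    rfl
  | succ n =>
    change MvPolynomial.aeval _ (equivE.symm (e (n + 1))) = _
    rw [equivE_symm_e, MvPolynomial.aeval_X]

/-- The counit of the Hopf algebra of symmetric functions: the constant term. -/
noncomputable def counit : SymmFun →ₐ[ℂ] ℂ where
  toRingHom := (constantCoeff (σ := ℕ) (R := ℂ)).comp (SymmFun.val : SymmFun →+* MvPowerSeries ℕ ℂ)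
  commutes' := fun r => constantCoeff_C (σ := ℕ) r

end SymmFun

/-- No two distinct blocks of the partition `π` of an `n`-element chain cross each other. -/
def IsNonCrossing {n : ℕ} (π : Finpartition (Finset.univ : Finset (Fin n))) : Prop :=
  ∀ a b c d : Fin n, a < b → b < c → c < d → c ∈ π.part a → d ∈ π.part b → b ∈ π.part a

instance {n : ℕ} : DecidablePred (IsNonCrossing (n := n)) := fun π => by
  unfold IsNonCrossing
  infer_instance

/-- The set `NC(n)` of non-crossing partitions of an `n`-element chain. -/
def NC (n : ℕ) : Finset (Finpartition (Finset.univ : Finset (Fin n))) :=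
  Finset.univ.filter IsNonCrossing

namespace NC

variable {n : ℕ} (π : Finpartition (Finset.univ : Finset (Fin n)))

/-- The cyclic permutation `b₁ ↦ b₂ ↦ ⋯ ↦ bₘ ↦ b₁` of a set `B = {b₁ < b₂ < ⋯ < bₘ}`. -/
def blockCycle (B : Finset (Fin n)) : Equiv.Perm (Fin n) :=
  (B.sort (· ≤ ·)).formPerm

theorem blockCycle_mem {B : Finset (Fin n)} {i : Fin n} : blockCycle B i ∈ B ↔ i ∈ B := by
  rw [← Finset.mem_sort (s := B) (· ≤ ·), ← Finset.mem_sort (s := B) (· ≤ ·)]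
  exact List.formPerm_mem_iff_mem

theorem part_blockCycle (i : Fin n) : π.part (blockCycle (π.part i) i) = π.part i :=
  π.part_eq_of_mem (π.part_mem.2 (Finset.mem_univ i))
    (blockCycle_mem.2 (π.mem_part_self.2 (Finset.mem_univ i)))

theorem part_blockCycle_symm (i : Fin n) : π.part ((blockCycle (π.part i)).symm i) = π.part i :=
  π.part_eq_of_mem (π.part_mem.2 (Finset.mem_univ i)) (by
    rw [← blockCycle_mem, Equiv.apply_symm_apply]
    exact π.mem_part_self.2 (Finset.mem_univ i))

/-- The permutation `P_π` associated to a partition `π`: its cycles are the blocks of `π`, each of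
them run through in increasing order. -/
def perm : Equiv.Perm (Fin n) where
  toFun i := blockCycle (π.part i) i
  invFun i := (blockCycle (π.part i)).symm i
  left_inv i := by
    dsimp only
    rw [part_blockCycle, Equiv.symm_apply_apply]
  right_inv i := by
    dsimp only
    rw [part_blockCycle_symm, Equiv.apply_symm_apply]

/-- The Kreweras complement of `π`: the partition whose blocks are the cycles of the permutation
`P_π⁻¹ P_{1ₙ}`, where `P_{1ₙ}` is the long cycle `1 ↦ 2 ↦ ⋯ ↦ n ↦ 1`. -/
def kreweras : Finpartition (Finset.univ : Finset (Fin n)) :=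
  @Finpartition.ofSetoid (Fin n) _ _ (Equiv.Perm.SameCycle.setoid ((perm π)⁻¹ * finRotate n))
    (inferInstanceAs (DecidableRel (Equiv.Perm.SameCycle ((perm π)⁻¹ * finRotate n))))

end NC

/-- The polynomial algebra `ℂ[Y₂, Y₃, Y₄, …]`. -/
abbrev YAlg : Type := MvPolynomial {n : ℕ // 2 ≤ n} ℂ

namespace YAlg

/-- The element `Yₙ`, with the convention `Y₁ = 1`. -/
noncomputable def Y (n : ℕ) : YAlg := if h : 2 ≤ n then MvPolynomial.X ⟨n, h⟩ else 1

/-- `Y_π` is the product of `Y_{|A|}` over the blocks `A` of `π`. -/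
noncomputable def Ypart {n : ℕ} (π : Finpartition (Finset.univ : Finset (Fin n))) : YAlg :=
  ∏ A ∈ π.parts, Y A.card

/-- The comultiplication: `Δ Yₙ = ∑ Y_π ⊗ Y_{K(π)}`, summed over `π ∈ NC(n)`. -/
noncomputable def comul : YAlg →ₐ[ℂ] YAlg ⊗[ℂ] YAlg :=
  MvPolynomial.aeval fun n => ∑ π ∈ NC n.1, Ypart π ⊗ₜ[ℂ] Ypart (NC.kreweras π)

/-- The counit: `ε Yₙ = 0` for `n ≥ 2`. -/
noncomputable def counit : YAlg →ₐ[ℂ] ℂ :=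
  MvPolynomial.aeval fun _ => 0

/-- The grading for which `Yₙ` is homogeneous of degree `n - 1`. -/
noncomputable def grading (d : ℕ) : Submodule ℂ YAlg :=
  MvPolynomial.weightedHomogeneousSubmodule ℂ (fun n : {n : ℕ // 2 ≤ n} => n.1 - 1) d

end YAlg

/-- The symmetric function `yₙ = ∑ ∏ e_{|A|}`: the sum is over `π ∈ NC(n-1)`, the product over
the blocks `A` of `π`. -/
noncomputable def SymmFun.y (n : ℕ) : SymmFun :=
  ∑ π ∈ NC (n - 1), ∏ A ∈ π.parts, SymmFun.e A.card

/-- The unital algebra homomorphism `Φ` with `Φ Yₙ = yₙ` for `n ≥ 2`. -/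
noncomputable def Phi : YAlg →ₐ[ℂ] SymmFun :=
  MvPolynomial.aeval fun n => SymmFun.y n.1

section Hopf

variable {A B : Type} [CommRing A] [Algebra ℂ A] [CommRing B] [Algebra ℂ B]

/-- The algebra `A`, with comultiplication `Δ`, counit `ε`, antipode `S` and homogeneous
subspaces `𝒜 n`, is a graded Hopf algebra over `ℂ`. -/
structure IsGradedHopfAlgebra (Δ : A →ₐ[ℂ] A ⊗[ℂ] A) (ε : A →ₐ[ℂ] ℂ) (S : A →ₗ[ℂ] A)
    (𝒜 : ℕ → Submodule ℂ A) : Prop where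
  coassoc : (Algebra.TensorProduct.assoc ℂ ℂ ℂ A A A).toAlgHom.comp
    ((Algebra.TensorProduct.map Δ (.id ℂ A)).comp Δ) =
      (Algebra.TensorProduct.map (.id ℂ A) Δ).comp Δ
  rTensor_counit : (Algebra.TensorProduct.map ε (.id ℂ A)).comp Δ =
    (Algebra.TensorProduct.lid ℂ A).symm
  lTensor_counit : (Algebra.TensorProduct.map (.id ℂ A) ε).comp Δ =
    (Algebra.TensorProduct.rid ℂ ℂ A).symm
  mul_antipode_rTensor : LinearMap.mul' ℂ A ∘ₗ S.rTensor A ∘ₗ Δ.toLinearMap =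
    Algebra.linearMap ℂ A ∘ₗ ε.toLinearMap
  mul_antipode_lTensor : LinearMap.mul' ℂ A ∘ₗ S.lTensor A ∘ₗ Δ.toLinearMap =
    Algebra.linearMap ℂ A ∘ₗ ε.toLinearMap
  isInternal : DirectSum.IsInternal 𝒜
  one_mem : 1 ∈ 𝒜 0
  mul_mem : ∀ m n : ℕ, ∀ a ∈ 𝒜 m, ∀ b ∈ 𝒜 n, a * b ∈ 𝒜 (m + n)
  counit_eq_zero : ∀ n : ℕ, 1 ≤ n → ∀ a ∈ 𝒜 n, ε a = 0
  comul_mem : ∀ n : ℕ, ∀ a ∈ 𝒜 n, Δ a ∈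
    ⨆ i ∈ Finset.range (n + 1),
      LinearMap.range (TensorProduct.map (𝒜 i).subtype (𝒜 (n - i)).subtype)

/-- The algebra homomorphism `φ` is an isomorphism of graded Hopf algebras: it is bijective and
compatible with comultiplications, counits, antipodes and gradings. -/
structure IsGradedHopfIso (ΔA : A →ₐ[ℂ] A ⊗[ℂ] A) (εA : A →ₐ[ℂ] ℂ) (SA : A →ₗ[ℂ] A)
    (𝒜 : ℕ → Submodule ℂ A) (ΔB : B →ₐ[ℂ] B ⊗[ℂ] B) (εB : B →ₐ[ℂ] ℂ) (SB : B →ₗ[ℂ] B)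
    (ℬ : ℕ → Submodule ℂ B) (φ : A →ₐ[ℂ] B) : Prop where
  bijective : Function.Bijective φ
  comul_comp : ΔB.comp φ = (Algebra.TensorProduct.map φ φ).comp ΔA
  counit_comp : εB.comp φ = εA
  antipode_comp : SB ∘ₗ φ.toLinearMap = φ.toLinearMap ∘ₗ SA
  map_grading : ∀ n : ℕ, (𝒜 n).map φ.toLinearMap = ℬ n

end Hopf

/-! Let E(t) = ∑ e_k t^k and L(t) = ∑ y_{n+1} t^n. Cutting a non-crossing partition along the block
of its first element gives L = E(tL), and this equation has only one solution
(`genFun_one_eq_subst`, `eq_of_eq_subst`). The comultiplication of Sym makes E multiplicative, so it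
sends L to the solution belonging to a product E E'. It has to be shown that the sums of y_π
y'_{K(π)} over NC(n+1) have this same generating function.

Consider more generally the sum over π of ∏ f(|A|) over the blocks of π times ∏ g(|B|) over the
blocks of K(π). Removing the first element gives the recursion `krewerasSum`, whose two extra
parameters record what removed elements have added to the first block of π and to the last block of
K(π). It is proved for permutations supported on an interval [a, b): either a is fixed, or a is sent
to some j and the permutation is the transposition of a and j times non-crossing permutations of (a,
j) and [j, b); the complement then factors as well (`sum_ncSet`, `pairSum_eq`). In terms of F = ∑
f(1+i) t^i and G = ∑ g(1+i) t^i the recursion says L = U F(tU) with U = G(t F(tU)). If F = E(tF) and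
G = E'(tG), then F(tU) = E(tL) and U = E'(tL), so L = (E E')(tL) (`shiftGenFun_eq_subst`). This is
the compatibility of Φ with the comultiplications.

The map Φ is bijective because y_{n+1} is e_n plus a polynomial in e_1, …, e_{n-1}; solving for e_n
gives a degree-preserving inverse. The Hopf axioms are checked directly only for Sym, on the
generators e_n, and are transported to the Y-algebra along Φ. In particular its coassociativity
needs no combinatorics of Kreweras complements, and its antipode is the conjugate of that of Sym. -/

namespace NCPerm

/-! ### Orbits, orbit weights and long cycles of intervals. -/

open Equiv Equiv.Perm Finset

/-- Lying on the same cycle is the least equivalence relation containing all pairs `u`, `σ u`, so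
invariants of orbits need checking for one application of `σ` only. -/
theorem rel_of_sameCycle {α : Type*} {σ : Perm α} {r : α → α → Prop} (hr : Equivalence r)
    (h : ∀ u, r u (σ u)) {u v : α} (huv : σ.SameCycle u v) : r u v := by
  obtain ⟨n, rfl⟩ := huv
  induction n using Int.induction_on with
  | zero => exact hr.refl _
  | succ n ih =>
    rw [add_comm, zpow_add, zpow_one, mul_apply]
    exact hr.trans ih (h _)
  | pred n ih =>
    refine hr.trans ih (hr.symm ?_)
    have := h ((σ ^ (-(n : ℤ) - 1)) u)
    rwa [← mul_apply, ← zpow_one_add, add_sub_cancel] at this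

theorem mem_of_sameCycle {σ : Perm ℕ} {S : Finset ℕ} (h : ∀ x ∉ S, σ x = x) {x y : ℕ}
    (hx : x ∈ S) (hxy : σ.SameCycle x y) : y ∈ S := by
  by_contra hy
  exact hy (hxy.eq_of_right (h y hy) ▸ hx)

open Classical in
/-- The part of the orbit of `x` that lies in `S`. -/
noncomputable def orbit (σ : Perm ℕ) (S : Finset ℕ) (x : ℕ) : Finset ℕ :=
  {y ∈ S | σ.SameCycle x y}

theorem mem_orbit {σ : Perm ℕ} {S : Finset ℕ} {x y : ℕ} :
    y ∈ orbit σ S x ↔ y ∈ S ∧ σ.SameCycle x y := by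
  simp [orbit]

/-- The set of orbits of `σ` on `S`. -/
noncomputable def orbits (σ : Perm ℕ) (S : Finset ℕ) : Finset (Finset ℕ) := S.image (orbit σ S)

theorem mem_orbits {σ : Perm ℕ} {S B : Finset ℕ} :
    B ∈ orbits σ S ↔ ∃ x ∈ S, orbit σ S x = B := by
  simp [orbits]

theorem subset_of_mem_orbits {σ : Perm ℕ} {S B : Finset ℕ} (h : B ∈ orbits σ S) : B ⊆ S := by
  obtain ⟨x, -, rfl⟩ := mem_orbits.1 h
  exact fun y hy => (mem_orbit.1 hy).1

theorem nonempty_of_mem_orbits {σ : Perm ℕ} {S B : Finset ℕ} (h : B ∈ orbits σ S) :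
    B.Nonempty := by
  obtain ⟨x, hx, rfl⟩ := mem_orbits.1 h
  exact ⟨x, mem_orbit.2 ⟨hx, .rfl⟩⟩

theorem orbit_eq_of_mem {σ : Perm ℕ} {S : Finset ℕ} {x y : ℕ} (h : y ∈ orbit σ S x) :
    orbit σ S x = orbit σ S y := by
  ext z
  rw [mem_orbit, mem_orbit]
  have := (mem_orbit.1 h).2
  exact and_congr_right fun _ => ⟨this.symm.trans, this.trans⟩

theorem orbits_inv (σ : Perm ℕ) (S : Finset ℕ) : orbits σ⁻¹ S = orbits σ S := by
  have : orbit σ⁻¹ S = orbit σ S := by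
    ext x y
    rw [mem_orbit, mem_orbit, sameCycle_inv]
  rw [orbits, this, orbits]

theorem sameCycle_mul_iff {σ τ : Perm ℕ} {S T : Finset ℕ} (hST : Disjoint S T)
    (hσ : ∀ x ∉ S, σ x = x) (hτ : ∀ x ∉ T, τ x = x) {x y : ℕ} (hx : x ∈ S) :
    (σ * τ).SameCycle x y ↔ σ.SameCycle x y := by
  have hd : σ.Disjoint τ := fun z => by
    by_cases hz : z ∈ S
    · exact Or.inr (hτ z (Finset.disjoint_left.1 hST hz))
    · exact Or.inl (hσ z hz)
  refine exists_congr fun n => ?_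
  rw [hd.commute.mul_zpow, mul_apply,
    zpow_apply_eq_self_of_apply_eq_self (hτ x (Finset.disjoint_left.1 hST hx))]

theorem orbit_mul {σ τ : Perm ℕ} {S T : Finset ℕ} (hST : Disjoint S T)
    (hσ : ∀ x ∉ S, σ x = x) (hτ : ∀ x ∉ T, τ x = x) {x : ℕ} (hx : x ∈ S) :
    orbit (σ * τ) (S ∪ T) x = orbit σ S x := by
  ext y
  rw [mem_orbit, mem_orbit, sameCycle_mul_iff hST hσ hτ hx, mem_union]
  exact ⟨fun h => ⟨mem_of_sameCycle hσ hx h.2, h.2⟩, fun h => ⟨Or.inl h.1, h.2⟩⟩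

theorem mul_comm_of_disjoint {σ τ : Perm ℕ} {S T : Finset ℕ} (hST : Disjoint S T)
    (hσ : ∀ x ∉ S, σ x = x) (hτ : ∀ x ∉ T, τ x = x) : σ * τ = τ * σ := by
  have hd : σ.Disjoint τ := fun z => by
    by_cases hz : z ∈ S
    · exact Or.inr (hτ z (Finset.disjoint_left.1 hST hz))
    · exact Or.inl (hσ z hz)
  exact hd.commute

theorem orbits_mul {σ τ : Perm ℕ} {S T : Finset ℕ} (hST : Disjoint S T)
    (hσ : ∀ x ∉ S, σ x = x) (hτ : ∀ x ∉ T, τ x = x) :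
    orbits (σ * τ) (S ∪ T) = orbits σ S ∪ orbits τ T := by
  rw [orbits, image_union]
  congr 1
  · exact image_congr fun x hx => orbit_mul hST hσ hτ hx
  · refine image_congr fun x hx => ?_
    rw [mul_comm_of_disjoint hST hσ hτ, union_comm]
    exact orbit_mul hST.symm hτ hσ hx

variable {R : Type*} [CommRing R]

/-- The product over the orbits `B` of `σ` on `S` of `f` at the total mass of `B`. -/
noncomputable def weight (f : ℕ → R) (m : ℕ → ℕ) (S : Finset ℕ) (σ : Perm ℕ) : R :=
  ∏ B ∈ orbits σ S, f (∑ x ∈ B, m x)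

theorem weight_inv (f : ℕ → R) (m : ℕ → ℕ) (S : Finset ℕ) (σ : Perm ℕ) :
    weight f m S σ⁻¹ = weight f m S σ := by
  rw [weight, orbits_inv, weight]

theorem weight_congr (f : ℕ → R) {m m' : ℕ → ℕ} {S : Finset ℕ} (h : ∀ x ∈ S, m x = m' x)
    (σ : Perm ℕ) : weight f m S σ = weight f m' S σ :=
  prod_congr rfl fun _ hB => congrArg f
    (sum_congr rfl fun _ hx => h _ (subset_of_mem_orbits hB hx))

theorem weight_empty (f : ℕ → R) (m : ℕ → ℕ) (σ : Perm ℕ) : weight f m ∅ σ = 1 := rfl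

theorem weight_singleton (f : ℕ → R) (m : ℕ → ℕ) (a : ℕ) (σ : Perm ℕ) :
    weight f m {a} σ = f (m a) := by
  have : orbit σ {a} a = {a} := by
    ext y
    rw [mem_orbit, mem_singleton]
    exact ⟨fun h => h.1, fun h => ⟨h, h ▸ .rfl⟩⟩
  rw [weight, orbits, image_singleton, prod_singleton, this, sum_singleton]

theorem weight_mul (f : ℕ → R) (m : ℕ → ℕ) {σ τ : Perm ℕ} {S T : Finset ℕ} (hST : Disjoint S T)
    (hσ : ∀ x ∉ S, σ x = x) (hτ : ∀ x ∉ T, τ x = x) :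
    weight f m (S ∪ T) (σ * τ) = weight f m S σ * weight f m T τ := by
  rw [weight, orbits_mul hST hσ hτ, prod_union]
  · rfl
  · refine Finset.disjoint_left.2 fun B hB hB' => ?_
    obtain ⟨x, hx⟩ := nonempty_of_mem_orbits hB
    exact Finset.disjoint_left.1 hST (subset_of_mem_orbits hB hx) (subset_of_mem_orbits hB' hx)

/-- Multiplying by `swap y x` inserts the fixed point `y` into the cycle of `x`, immediately before
`x`. Collapsing `y` onto `x` therefore recovers the orbits of `σ`. -/
theorem sameCycle_swap_mul {σ : Perm ℕ} {x y : ℕ} (hy : σ y = y) (u v : ℕ) :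
    (swap y x * σ).SameCycle u v ↔
      σ.SameCycle (if u = y then x else u) (if v = y then x else v) := by
  set c : ℕ → ℕ := fun u => if u = y then x else u with hc
  have hcy : c y = x := if_pos rfl
  have hcn : ∀ u, u ≠ y → c u = u := fun u hu => if_neg hu
  have hρy : (swap y x * σ) y = x := by rw [mul_apply, hy, swap_apply_left]
  constructor
  · refine rel_of_sameCycle (r := fun u v => σ.SameCycle (c u) (c v))
      ⟨fun _ => .rfl, fun h => h.symm, fun h h' => h.trans h'⟩ fun u => ?_
    by_cases hu : u = y
    · subst hu
      rw [hρy, hcy]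
      by_cases hx : x = u
      · rw [hx, hcy, hx]
      · rw [hcn x hx]
    · have hσu : σ u ≠ y := fun h => hu (σ.injective (h.trans hy.symm))
      rw [hcn u hu, mul_apply]
      by_cases hx : σ u = x
      · rw [hx, swap_apply_right, hcy, ← hx, sameCycle_apply_right]
      · rw [swap_apply_of_ne_of_ne hσu hx, hcn _ hσu, sameCycle_apply_right]
  · have hcu : ∀ u, (swap y x * σ).SameCycle u (c u) := fun u => by
      by_cases hu : u = y
      · subst hu
        rw [hcy]
        conv => arg 3; rw [← hρy]
        exact sameCycle_apply_right.2 .rfl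
      · rw [hcn u hu]
    refine fun h => (hcu u).trans (SameCycle.trans ?_ (hcu v).symm)
    refine rel_of_sameCycle (SameCycle.equivalence (swap y x * σ)) (fun u => ?_) h
    by_cases hu : u = y
    · rw [hu, hy]
    · have hσu : σ u ≠ y := fun h => hu (σ.injective (h.trans hy.symm))
      by_cases hx : σ u = x
      · have h1 : (swap y x * σ) u = y := by rw [mul_apply, hx, swap_apply_right]
        have h2 : (swap y x * σ) ((swap y x * σ) u) = σ u := by rw [h1, hρy, hx]
        rw [← h2, sameCycle_apply_right, sameCycle_apply_right]
      · have h1 : (swap y x * σ) u = σ u := by rw [mul_apply, swap_apply_of_ne_of_ne hσu hx]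
        rw [← h1, sameCycle_apply_right]

theorem orbits_swap_mul {σ : Perm ℕ} {S : Finset ℕ} (hσ : ∀ z ∉ S, σ z = z) {x y : ℕ}
    (hx : x ∈ S) (hy : y ∉ S) :
    orbits (swap y x * σ) (insert y S) =
      insert (insert y (orbit σ S x)) ((orbits σ S).erase (orbit σ S x)) := by
  have hne : ∀ z ∈ S, z ≠ y := fun z hz h => hy (h ▸ hz)
  have h1 : ∀ u, σ.SameCycle (if u = y then x else u) x →
      orbit (swap y x * σ) (insert y S) u = insert y (orbit σ S x) := fun u hu => by
    ext v
    rw [mem_orbit, mem_insert, mem_insert, mem_orbit, sameCycle_swap_mul (hσ y hy)]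
    by_cases hv : v = y
    · simp [hv, hu]
    · simp only [hv, false_or, if_false]
      exact and_congr_right fun _ => ⟨hu.symm.trans, hu.trans⟩
  have h2 : ∀ u ∈ S, ¬ σ.SameCycle u x →
      orbit (swap y x * σ) (insert y S) u = orbit σ S u := fun u hu hux => by
    ext v
    rw [mem_orbit, mem_insert, mem_orbit, sameCycle_swap_mul (hσ y hy), if_neg (hne u hu)]
    by_cases hv : v = y
    · simp [hv, hux, hy]
    · simp only [hv, false_or, if_false]
  ext B
  rw [mem_orbits, mem_insert, mem_erase, mem_orbits]
  constructor
  · rintro ⟨u, hu, rfl⟩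
    by_cases hux : σ.SameCycle (if u = y then x else u) x
    · exact Or.inl (h1 u hux)
    · have huy : u ≠ y := by
        rintro rfl
        exact hux (by rw [if_pos rfl])
      rw [if_neg huy] at hux
      have huS := mem_of_mem_insert_of_ne hu huy
      rw [h2 u huS hux]
      refine Or.inr ⟨fun h => hux ?_, u, huS, rfl⟩
      exact (mem_orbit.1 (h ▸ mem_orbit.2 ⟨hx, .rfl⟩ : x ∈ orbit σ S u)).2
  · rintro (rfl | ⟨hB, u, hu, rfl⟩)
    · exact ⟨y, mem_insert_self _ _, h1 y (by rw [if_pos rfl])⟩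
    · refine ⟨u, mem_insert_of_mem hu, h2 u hu fun h => hB ?_⟩
      exact orbit_eq_of_mem (mem_orbit.2 ⟨hx, h⟩)

/-- A weight sees an orbit only through its total mass, so an inserted point may be dropped once its
mass is moved to `x`. This is why weights use a mass function instead of cardinalities. -/
theorem weight_swap_mul (f : ℕ → R) (m : ℕ → ℕ) {σ : Perm ℕ} {S : Finset ℕ}
    (hσ : ∀ z ∉ S, σ z = z) {x y : ℕ} (hx : x ∈ S) (hy : y ∉ S) :
    weight f m (insert y S) (swap y x * σ) = weight f (Function.update m x (m x + m y)) S σ := by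
  have hB : orbit σ S x ∈ orbits σ S := mem_orbits.2 ⟨x, hx, rfl⟩
  have hxB : x ∈ orbit σ S x := mem_orbit.2 ⟨hx, .rfl⟩
  rw [weight, orbits_swap_mul hσ hx hy, prod_insert, weight, ← mul_prod_erase _ _ hB]
  · refine congrArg₂ (· * ·) (congrArg f ?_) ?_
    · rw [sum_insert fun h => hy (mem_orbit.1 h).1, ← add_sum_erase _ _ hxB,
        ← add_sum_erase _ _ hxB, Function.update_self,
        sum_congr rfl fun z hz => Function.update_of_ne (ne_of_mem_erase hz) _ _]
      ring
    · refine prod_congr rfl fun B hB' => congrArg f (sum_congr rfl fun z hz => ?_)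
      rw [Function.update_of_ne]
      rintro rfl
      obtain ⟨hne, hB'⟩ := mem_erase.1 hB'
      obtain ⟨u, hu, rfl⟩ := mem_orbits.1 hB'
      exact hne (orbit_eq_of_mem hz)
  · intro h
    exact hy (subset_of_mem_orbits (mem_of_mem_erase h) (mem_insert_self _ _))

/-- The cycle `a ↦ a + 1 ↦ ⋯ ↦ b - 1 ↦ a`. -/
def cyc (a b : ℕ) : Perm ℕ where
  toFun x := if a ≤ x ∧ x < b then (if x + 1 < b then x + 1 else a) else x
  invFun x := if a ≤ x ∧ x < b then (if x = a then b - 1 else x - 1) else x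
  left_inv x := by
    dsimp only
    split_ifs <;> omega
  right_inv x := by
    dsimp only
    split_ifs <;> omega

theorem cyc_apply (a b x : ℕ) :
    cyc a b x = if a ≤ x ∧ x < b then (if x + 1 < b then x + 1 else a) else x := rfl

theorem cyc_apply_of_notMem {a b x : ℕ} (h : x ∉ Ico a b) : cyc a b x = x := by
  rw [mem_Ico] at h
  rw [cyc_apply, if_neg h]

/-- Inverting this puts the transposition on the left: in the complement of a permutation fixing
`a`, the point `a` is inserted into the orbit of `b - 1`. -/
theorem cyc_eq_mul_swap {a b : ℕ} (h : a + 1 < b) :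
    cyc a b = cyc (a + 1) b * swap a (b - 1) := by
  ext x
  rw [mul_apply, swap_apply_def]
  simp only [cyc_apply]
  split_ifs <;> omega

/-- The long cycle is cut at `j` by the same transposition that splits off a permutation sending `a`
to `j`; in the complement the two transpositions cancel. -/
theorem swap_mul_cyc {a j b : ℕ} (h : a < j) (hj : j < b) :
    swap a j * cyc a b = cyc a j * cyc j b := by
  ext x
  rw [mul_apply, mul_apply, swap_apply_def]
  simp only [cyc_apply]
  split_ifs <;> omega

/-! ### Non-crossing permutations of an interval, classified by the image of the least point. -/

theorem apply_mem_iff {σ : Perm ℕ} {S : Finset ℕ} (h : ∀ x ∉ S, σ x = x) (x : ℕ) :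
    σ x ∈ S ↔ x ∈ S := by
  by_cases hx : x ∈ S
  · refine iff_of_true ?_ hx
    by_contra h'
    exact h' (by rwa [σ.injective (h _ h')])
  · rw [h x hx]

theorem apply_mem_iff_of_mapsTo {σ : Perm ℕ} {S : Finset ℕ} (h : ∀ x ∈ S, σ x ∈ S) (x : ℕ) :
    σ x ∈ S ↔ x ∈ S := by
  have hbij := (S.finite_toSet.injOn_iff_bijOn_of_mapsTo (f := σ) h).1 σ.injective.injOn
  refine ⟨fun hx => ?_, h x⟩
  obtain ⟨y, hy, hyx⟩ := hbij.surjOn hx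
  rwa [← σ.injective hyx]

/-- The permutations of `{a, …, b - 1}`, extended by the identity, whose cycles are increasing and
do not cross each other. -/
structure IsNC (a b : ℕ) (σ : Perm ℕ) : Prop where
  apply_eq : ∀ x ∉ Ico a b, σ x = x
  nested : ∀ x y, x < y → y < σ x → x < σ y ∧ σ y < σ x

open Classical in
/-- The finite set of non-crossing permutations of `{a, …, b - 1}`. -/
noncomputable def ncSet (a b : ℕ) : Finset (Perm ℕ) :=
  ((univ : Finset (Perm (Ico a b))).image ofSubtype).filter (IsNC a b)

theorem mem_ncSet {a b : ℕ} {σ : Perm ℕ} : σ ∈ ncSet a b ↔ IsNC a b σ := by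
  classical
  rw [ncSet, mem_filter, and_iff_right_iff_imp]
  intro h
  rw [mem_image]
  have h1 := apply_mem_iff h.apply_eq
  exact ⟨σ.subtypePerm h1, mem_univ _, ofSubtype_subtypePerm h1 fun x hx => by
    by_contra h'
    exact hx (h.apply_eq x h')⟩

theorem exists_restrict {σ : Perm ℕ} {S : Finset ℕ} (h : ∀ x, σ x ∈ S ↔ x ∈ S) :
    ∃ τ : Perm ℕ, (∀ x ∈ S, τ x = σ x) ∧ ∀ x ∉ S, τ x = x :=
  ⟨ofSubtype (σ.subtypePerm h), fun _ hx => ofSubtype_subtypePerm_of_mem h hx,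
    fun _ hx => ofSubtype_subtypePerm_of_not_mem h hx⟩

/-- The product inserts `a` just before `j` in its `τ`-cycle. The new arc from `a` to `j` covers
only points moved within `(a, j)` by `σ`, and the `τ`-preimage of `j` now descends to `a`, where
nestedness demands nothing. -/
theorem IsNC.swap_mul {a j b : ℕ} (haj : a < j) (hjb : j < b) {σ τ : Perm ℕ}
    (hσ : IsNC (a + 1) j σ) (hτ : IsNC j b τ) : IsNC a b (swap a j * (σ * τ)) := by
  have hτm := apply_mem_iff hτ.apply_eq
  have hσm := apply_mem_iff hσ.apply_eq
  simp only [mem_Ico] at hτm hσm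
  have e1 : ∀ x, x < a ∨ b ≤ x → (swap a j * (σ * τ)) x = x := fun x hx => by
    rw [mul_apply, mul_apply, hτ.apply_eq x (by rw [mem_Ico]; omega),
      hσ.apply_eq x (by rw [mem_Ico]; omega), swap_apply_of_ne_of_ne (by omega) (by omega)]
  have e2 : (swap a j * (σ * τ)) a = j := by
    rw [mul_apply, mul_apply, hτ.apply_eq a (by rw [mem_Ico]; omega),
      hσ.apply_eq a (by rw [mem_Ico]; omega), swap_apply_left]
  have e3 : ∀ x, a + 1 ≤ x → x < j → (swap a j * (σ * τ)) x = σ x := fun x hx hx' => by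
    have := (hσm x).2 ⟨hx, hx'⟩
    rw [mul_apply, mul_apply, hτ.apply_eq x (by rw [mem_Ico]; omega),
      swap_apply_of_ne_of_ne (by omega) (by omega)]
  have e4 : ∀ x, j ≤ x → x < b → τ x ≠ j → (swap a j * (σ * τ)) x = τ x := fun x hx hx' hne => by
    have := (hτm x).2 ⟨hx, hx'⟩
    rw [mul_apply, mul_apply, hσ.apply_eq (τ x) (by rw [mem_Ico]; omega),
      swap_apply_of_ne_of_ne (by omega) hne]
  have e5 : ∀ x, j ≤ x → x < b → τ x = j → (swap a j * (σ * τ)) x = a := fun x hx hx' he => by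
    rw [mul_apply, mul_apply, he, hσ.apply_eq j (by rw [mem_Ico]; omega), swap_apply_right]
  refine ⟨fun x hx => e1 x (by rw [mem_Ico] at hx; omega), fun x y hxy hy => ?_⟩
  by_cases h1 : x < a ∨ b ≤ x
  · rw [e1 x h1] at hy
    omega
  by_cases h2 : x = a
  · subst h2
    rw [e2] at hy ⊢
    rw [e3 y (by omega) hy]
    have := (hσm y).2 ⟨hxy, hy⟩
    omega
  by_cases h3 : x < j
  · have hx := (hσm x).2 ⟨by omega, h3⟩
    rw [e3 x (by omega) h3] at hy ⊢
    rw [e3 y (by omega) (by omega)]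
    exact hσ.nested x y hxy hy
  · by_cases h4 : τ x = j
    · rw [e5 x (by omega) (by omega) h4] at hy
      omega
    · rw [e4 x (by omega) (by omega) h4] at hy ⊢
      have hx := (hτm x).2 (by omega)
      have := hτ.nested x y hxy hy
      rw [e4 y (by omega) (by omega) (by omega)]
      exact this

/-- Nestedness under the arc from `a` to `ρ a` makes the open interval between them invariant, which
yields `σ`. The transposition then takes `a` out of its cycle, and what remains on `[ρ a, b)` is
`τ`. -/
theorem IsNC.exists_eq_swap_mul {a b : ℕ} {ρ : Perm ℕ} (h : IsNC a b ρ) (hj : a < ρ a) :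
    ∃ σ τ, IsNC (a + 1) (ρ a) σ ∧ IsNC (ρ a) b τ ∧ swap a (ρ a) * (σ * τ) = ρ := by
  obtain ⟨j, hja⟩ : ∃ j, j = ρ a := ⟨_, rfl⟩
  rw [← hja] at hj ⊢
  have hm := apply_mem_iff h.apply_eq
  simp only [mem_Ico] at hm
  have hab : a < b := by
    by_contra hab
    have := h.apply_eq a (by rw [mem_Ico]; omega)
    omega
  have hjb := (hm a).2 ⟨le_rfl, hab⟩
  have hin : ∀ y, a < y → y < j → a < ρ y ∧ ρ y < j := fun y h1 h2 =>
    hja ▸ h.nested a y h1 (hja ▸ h2)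
  have hinj : ∀ x y, ρ x = ρ y → x = y := fun x y hxy => ρ.injective hxy
  have hiff1 : ∀ x, ρ x ∈ Ico (a + 1) j ↔ x ∈ Ico (a + 1) j := by
    refine apply_mem_iff_of_mapsTo fun x hx => ?_
    rw [mem_Ico] at hx ⊢
    exact hin x hx.1 hx.2
  obtain ⟨σ, hσ, hσ'⟩ := exists_restrict hiff1
  simp only [mem_Ico] at hiff1 hσ hσ'
  have hiff2 : ∀ x, (swap a j * ρ) x ∈ Ico j b ↔ x ∈ Ico j b := by
    intro x
    rw [mul_apply, mem_Ico, mem_Ico]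
    have h1 := hiff1 x
    have h2 := hm x
    have h3 := hinj x a
    rw [swap_apply_def]
    by_cases hxa : x = a
    · subst hxa
      rw [← hja, if_neg hj.ne', if_pos rfl]
    · split_ifs <;> omega
  obtain ⟨τ, hτ, hτ'⟩ := exists_restrict hiff2
  simp only [mem_Ico, mul_apply] at hiff2 hτ hτ'
  have hτge : ∀ x, j ≤ x → x < b → ρ x ≠ a → τ x = ρ x := fun x h1 h2 h3 => by
    rw [hτ x ⟨h1, h2⟩, swap_apply_of_ne_of_ne h3]
    rw [hja]
    intro h4
    have := hinj _ _ h4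
    omega
  refine ⟨σ, τ, ⟨fun x hx => hσ' x (by rwa [mem_Ico] at hx), fun x y hxy hy => ?_⟩,
    ⟨fun x hx => hτ' x (by rwa [mem_Ico] at hx), fun x y hxy hy => ?_⟩, ?_⟩
  · by_cases hx : a + 1 ≤ x ∧ x < j
    · have h1 := hin x hx.1 hx.2
      rw [hσ x hx] at hy ⊢
      rw [hσ y (by omega)]
      exact h.nested x y hxy hy
    · rw [hσ' x hx] at hy
      omega
  · by_cases hx : j ≤ x ∧ x < b
    · by_cases hxa : ρ x = a
      · rw [hτ x hx, hxa, swap_apply_left] at hy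
        omega
      · have h0 := (hm x).2 (by omega)
        rw [hτge x hx.1 hx.2 hxa] at hy ⊢
        have := h.nested x y hxy hy
        rw [hτge y (by omega) (by omega) (by omega)]
        exact this
    · rw [hτ' x hx] at hy
      omega
  · ext x
    rw [mul_apply, mul_apply]
    by_cases hx : j ≤ x ∧ x < b
    · have h1 := (hiff2 x).2 hx
      rw [hτ x hx, hσ' _ (by omega), ← mul_apply, swap_mul_self, one_apply]
    · rw [hτ' x hx]
      by_cases hx' : a + 1 ≤ x ∧ x < j
      · have h1 := hin x hx'.1 hx'.2
        rw [hσ x hx', swap_apply_of_ne_of_ne (by omega) (by omega)]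
      · rw [hσ' x hx']
        by_cases hxa : x = a
        · rw [hxa, swap_apply_left, hja]
        · rw [swap_apply_of_ne_of_ne hxa (by omega), h.apply_eq x (by rw [mem_Ico]; omega)]

theorem isNC_succ_iff {a b : ℕ} {σ : Perm ℕ} : IsNC (a + 1) b σ ↔ IsNC a b σ ∧ σ a = a := by
  constructor
  · intro h
    exact ⟨⟨fun x hx => h.apply_eq x (by rw [mem_Ico] at hx ⊢; omega), h.nested⟩,
      h.apply_eq a (by rw [mem_Ico]; omega)⟩
  · rintro ⟨h, ha⟩
    refine ⟨fun x hx => ?_, h.nested⟩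
    by_cases hxa : x = a
    · rw [hxa, ha]
    · exact h.apply_eq x (by rw [mem_Ico] at hx ⊢; omega)

theorem sum_ncSet {M : Type*} [AddCommMonoid M] {a b : ℕ} (hab : a < b) (F : Perm ℕ → M) :
    ∑ σ ∈ ncSet a b, F σ = ∑ σ ∈ ncSet (a + 1) b, F σ +
      ∑ j ∈ Ioo a b, ∑ σ ∈ ncSet (a + 1) j, ∑ τ ∈ ncSet j b, F (swap a j * (σ * τ)) := by
  classical
  have hmaps : ∀ σ ∈ ncSet a b, σ a ∈ Ico a b := fun σ hσ =>
    (apply_mem_iff (mem_ncSet.1 hσ).apply_eq a).2 (by rw [mem_Ico]; omega)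
  rw [← sum_fiberwise_of_maps_to hmaps, ← Ioo_insert_left hab, sum_insert (by simp)]
  congr 1
  · refine sum_congr (Finset.ext fun σ => ?_) fun _ _ => rfl
    rw [mem_filter, mem_ncSet, mem_ncSet, isNC_succ_iff]
  · refine sum_congr rfl fun j hj => ?_
    rw [mem_Ioo] at hj
    rw [← sum_product']
    symm
    refine sum_bij (fun p _ => swap a j * (p.1 * p.2)) ?_ ?_ ?_ fun _ _ => rfl
    · rintro ⟨σ, τ⟩ hp
      rw [mem_product, mem_ncSet, mem_ncSet] at hp
      rw [mem_filter, mem_ncSet]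
      refine ⟨hp.1.swap_mul hj.1 hj.2 hp.2, ?_⟩
      rw [mul_apply, mul_apply, hp.2.apply_eq a (by rw [mem_Ico]; omega),
        hp.1.apply_eq a (by rw [mem_Ico]; omega), swap_apply_left]
    · rintro ⟨σ, τ⟩ hp ⟨σ', τ'⟩ hp' he
      rw [mem_product, mem_ncSet, mem_ncSet] at hp hp'
      have he := mul_left_cancel he
      have hτ := hp.2.apply_eq
      have hτ' := hp'.2.apply_eq
      have hσ := hp.1.apply_eq
      have hσ' := hp'.1.apply_eq
      simp only at hτ hτ' hσ hσ' he
      have hσσ : σ = σ' := by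
        ext x
        by_cases hx : x < j
        · have := DFunLike.congr_fun he x
          rwa [mul_apply, mul_apply, hτ x (by rw [mem_Ico]; omega),
            hτ' x (by rw [mem_Ico]; omega)] at this
        · rw [hσ x (by rw [mem_Ico]; omega), hσ' x (by rw [mem_Ico]; omega)]
      subst hσσ
      rw [mul_left_cancel he]
    · intro ρ hρ
      rw [mem_filter, mem_ncSet] at hρ
      obtain ⟨hρ, rfl⟩ := hρ
      obtain ⟨σ, τ, hσ, hτ, he⟩ := hρ.exists_eq_swap_mul hj.1
      exact ⟨(σ, τ), by rw [mem_product, mem_ncSet, mem_ncSet]; exact ⟨hσ, hτ⟩, he⟩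

theorem ncSet_of_le {a b : ℕ} (h : b ≤ a) : ncSet a b = {1} := by
  ext σ
  rw [mem_ncSet, mem_singleton]
  constructor
  · intro hσ
    ext x
    rw [hσ.apply_eq x (by rw [mem_Ico]; omega), one_apply]
  · rintro rfl
    refine ⟨fun _ _ => rfl, fun x y hxy hy => ?_⟩
    rw [one_apply] at hy
    omega

/-! ### The recursion for sums over a partition and its Kreweras complement. -/

/-- The sum over the non-crossing permutations `σ` of `{a, …, b - 1}` of the product of the weight
of `σ` and the weight of its Kreweras complement. -/
noncomputable def pairSum (f g : ℕ → R) (a b : ℕ) (m m' : ℕ → ℕ) : R :=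
  ∑ σ ∈ ncSet a b, weight f m (Ico a b) σ * weight g m' (Ico a b) ((cyc a b)⁻¹ * σ)

/-- The part of `pairSum` coming from the permutations which fix `a`, without the factor of the
orbit of `a`. -/
noncomputable def fixSum (f g : ℕ → R) (a b : ℕ) (m m' : ℕ → ℕ) : R :=
  ∑ σ ∈ ncSet (a + 1) b, weight f m (Ico (a + 1) b) σ * weight g m' (Ico a b) ((cyc a b)⁻¹ * σ)

theorem fixSum_singleton (f g : ℕ → R) (a : ℕ) (m m' : ℕ → ℕ) :
    fixSum f g a (a + 1) m m' = g (m' a) := by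
  rw [fixSum, ncSet_of_le le_rfl, sum_singleton, Ico_self, weight_empty, one_mul,
    Nat.Ico_succ_singleton, weight_singleton]

theorem inv_mul_apply_eq {σ τ : Perm ℕ} {S : Finset ℕ} (hσ : ∀ x ∉ S, σ x = x)
    (hτ : ∀ x ∉ S, τ x = x) : ∀ x ∉ S, (τ⁻¹ * σ) x = x := fun x hx => by
  rw [mul_apply, hσ x hx, inv_eq_iff_eq, hτ x hx]

theorem fixSum_eq_pairSum (f g : ℕ → R) {a b : ℕ} (hab : a + 1 < b) (m m' : ℕ → ℕ) :
    fixSum f g a b m m' =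
      pairSum f g (a + 1) b m (Function.update m' (b - 1) (m' (b - 1) + m' a)) := by
  refine sum_congr rfl fun σ hσ => ?_
  rw [cyc_eq_mul_swap hab, mul_inv_rev, swap_inv, mul_assoc,
    show Ico a b = insert a (Ico (a + 1) b) by
      ext x
      rw [mem_insert, mem_Ico, mem_Ico]
      omega, weight_swap_mul]
  · exact inv_mul_apply_eq (mem_ncSet.1 hσ).apply_eq fun _ => cyc_apply_of_notMem
  · rw [mem_Ico]; omega
  · simp

/-- If `a` goes to `j`, its mass passes to `j`, while the complement splits into a complement on
`[a, j)`, where `a` counts as a fixed point, and one on `[j, b)`. This explains the product of a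
`fixSum` and a `pairSum`. -/
theorem pairSum_eq (f g : ℕ → R) {a b : ℕ} (hab : a < b) (m m' : ℕ → ℕ) :
    pairSum f g a b m m' = f (m a) * fixSum f g a b m m' +
      ∑ j ∈ Ioo a b, fixSum f g a j m m' *
        pairSum f g j b (Function.update m j (m j + m a)) m' := by
  rw [pairSum, sum_ncSet hab]
  congr 1
  · rw [fixSum, mul_sum]
    refine sum_congr rfl fun σ hσ => ?_
    rw [← mul_assoc]
    congr 1
    have hd : Disjoint {a} (Ico (a + 1) b) := by simp
    have := weight_mul f m (σ := 1) hd (fun _ _ => rfl) (mem_ncSet.1 hσ).apply_eq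
    rw [one_mul, weight_singleton] at this
    rw [← this]
    congr 1
    ext x
    simp only [mem_union, mem_singleton, mem_Ico]
    omega
  · refine sum_congr rfl fun j hj => ?_
    rw [mem_Ioo] at hj
    rw [fixSum, pairSum, sum_mul_sum]
    refine sum_congr rfl fun σ hσ => sum_congr rfl fun τ hτ => ?_
    rw [mem_ncSet] at hσ hτ
    have hσa : ∀ x ∉ Ico a j, σ x = x := fun x hx =>
      hσ.apply_eq x (by rw [mem_Ico] at hx ⊢; omega)
    have hd : Disjoint (Ico (a + 1) j) (Ico j b) := Ico_disjoint_Ico_consecutive _ _ _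
    have hd' : Disjoint (Ico a j) (Ico j b) := Ico_disjoint_Ico_consecutive _ _ _
    have hu : Ico a b = insert a (Ico (a + 1) j ∪ Ico j b) := by
      ext x
      simp only [mem_union, mem_insert, mem_Ico]
      omega
    have h1 : weight f m (Ico a b) (swap a j * (σ * τ)) = weight f m (Ico (a + 1) j) σ *
        weight f (Function.update m j (m j + m a)) (Ico j b) τ := by
      rw [hu, weight_swap_mul, weight_mul f _ hd hσ.apply_eq hτ.apply_eq]
      · congr 1
        refine weight_congr f (fun x hx => Function.update_of_ne ?_ _ _) σ
        rw [mem_Ico] at hx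
        omega
      · intro z hz
        rw [mem_union, not_or] at hz
        rw [mul_apply, hτ.apply_eq z hz.2, hσ.apply_eq z hz.1]
      · simp [hj.2]
      · simp [hj.1]
    have h2 : weight g m' (Ico a b) ((cyc a b)⁻¹ * (swap a j * (σ * τ))) =
        weight g m' (Ico a j) ((cyc a j)⁻¹ * σ) * weight g m' (Ico j b) ((cyc j b)⁻¹ * τ) := by
      -- After the two transpositions cancel, the factors living on `[a, j)` commute with those
      -- living on `[j, b)` and can be regrouped.
      have h3 : (cyc a b)⁻¹ * (swap a j * (σ * τ)) =
          ((cyc a j)⁻¹ * σ) * ((cyc j b)⁻¹ * τ) := by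
        have h4 : cyc a b = swap a j * (cyc a j * cyc j b) := by
          rw [← swap_mul_cyc hj.1 hj.2, swap_mul_self_mul]
        have h5 : (cyc j b)⁻¹ * σ = σ * (cyc j b)⁻¹ := (mul_comm_of_disjoint hd' hσa
          (τ := (cyc j b)⁻¹) fun x hx => by rw [inv_eq_iff_eq, cyc_apply_of_notMem hx]).symm
        have h6 : cyc a j * cyc j b = cyc j b * cyc a j := mul_comm_of_disjoint hd'
          (fun _ => cyc_apply_of_notMem) fun _ => cyc_apply_of_notMem
        rw [h4, h6, mul_inv_rev, mul_inv_rev, swap_inv, mul_assoc _ (swap a j),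
          swap_mul_self_mul, mul_assoc, mul_assoc, ← mul_assoc _ σ, h5, mul_assoc]
      rw [h3, ← Ico_union_Ico_eq_Ico hj.1.le hj.2.le]
      exact weight_mul g m' hd' (inv_mul_apply_eq hσa fun _ => cyc_apply_of_notMem)
        (inv_mul_apply_eq hτ.apply_eq fun _ => cyc_apply_of_notMem)
    rw [h1, h2]
    ring

/-- The sum over the non-crossing partitions `π` of an `n`-element chain of the product of
`f |A|` over the blocks `A` of `π` and of `g |B|` over the blocks `B` of its Kreweras complement,
where `k` is added to the size of the first block of `π` and `l` to the size of the last block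
of the complement. -/
def krewerasSum (f g : ℕ → R) : ℕ → ℕ → ℕ → R
  | 0, _, l => g l
  | n + 1, k, l => f (k + 1) * krewerasSum f g n 0 (l + 1) +
      ∑ j : Fin n, krewerasSum f g j 0 1 * krewerasSum f g (n - j) (k + 1) l
termination_by n => n
decreasing_by all_goals omega

/-- Only the first mass of `m` and the last mass of `m'` may differ from `1`. Removing `a` preserves
this shape, since its mass goes to the new first point or to the last point of the complement; hence
two parameters suffice. -/
theorem pairSum_eq_krewerasSum (f g : ℕ → R) (n : ℕ) : ∀ (a k l : ℕ) (m m' : ℕ → ℕ),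
    m a = k + 1 → (∀ x, a < x → x ≤ a + n → m x = 1) → m' (a + n) = l + 1 →
    (∀ x, a ≤ x → x < a + n → m' x = 1) →
    pairSum f g a (a + n + 1) m m' = krewerasSum f g (n + 1) k l := by
  induction n using Nat.strong_induction_on with
  | _ n ih =>
  -- Fixing `a` sends its complement mass `1` to the last point, which raises `l` by one. For `i =
  -- 0` the point `a` is itself the last one, of mass `l + 1`.
  have hfix : ∀ i ≤ n, ∀ (a l : ℕ) (m m' : ℕ → ℕ), (∀ x, a < x → x ≤ a + i → m x = 1) →
      m' (a + i) = l + 1 → (∀ x, a ≤ x → x < a + i → m' x = 1) →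
      fixSum f g a (a + i + 1) m m' = krewerasSum f g i 0 (l + 1) := by
    intro i hi a l m m' hm hl hm'
    cases i with
    | zero => rw [add_zero, fixSum_singleton, krewerasSum, ← hl, add_zero]
    | succ i =>
      rw [fixSum_eq_pairSum f g (by omega), show a + (i + 1) + 1 = a + 1 + i + 1 by omega]
      refine ih i hi (a + 1) 0 (l + 1) _ _ (hm _ (by omega) (by omega))
        (fun x h1 h2 => hm x (by omega) (by omega)) ?_ fun x h1 h2 => ?_
      · rw [show a + 1 + i + 1 - 1 = a + 1 + i by omega, Function.update_self,
          hm' a le_rfl (by omega), show a + 1 + i = a + (i + 1) by omega, hl]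
      · rw [Function.update_of_ne (by omega)]
        exact hm' x (by omega) (by omega)
  intro a k l m m' hk hm hl hm'
  rw [pairSum_eq f g (by omega), hk, hfix n le_rfl a l m m' hm hl hm', krewerasSum]
  congr 1
  rw [Fin.sum_univ_eq_sum_range (fun j => krewerasSum f g j 0 1 * krewerasSum f g (n - j) (k + 1) l)]
  refine (sum_nbij (fun j => a + 1 + j) (fun j hj => ?_) (fun _ _ _ _ h => by simpa using h)
    (fun j hj => ?_) fun j hj => ?_).symm
  · rw [mem_range] at hj
    rw [mem_Ioo]
    omega
  · rw [mem_coe, mem_Ioo] at hj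
    exact ⟨j - (a + 1), by rw [mem_coe, mem_range]; omega, by dsimp only; omega⟩
  · rw [mem_range] at hj
    -- The left interval ends at a point of complement mass `1`, giving the parameter `0 + 1`; the
    -- right interval starts at a point of mass `1 + (k + 1)`, giving the parameter `k + 1`.
    rw [show a + 1 + j = a + j + 1 by omega,
      hfix j hj.le a 0 m m' (fun x h1 h2 => hm x h1 (by omega)) (hm' _ (by omega) (by omega))
        fun x h1 h2 => hm' x h1 (by omega)]
    obtain ⟨i, rfl⟩ : ∃ i, n = j + 1 + i := ⟨n - (j + 1), by omega⟩
    rw [show j + 1 + i - j = i + 1 by omega,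
      show a + (j + 1 + i) + 1 = a + j + 1 + i + 1 by omega]
    rw [ih i (by omega) (a + j + 1) (k + 1) l _ m']
    · rw [Function.update_self, hm _ (by omega) (by omega)]
      omega
    · intro x h1 h2
      rw [Function.update_of_ne (by omega)]
      exact hm x (by omega) (by omega)
    · rw [← hl]
      congr 1
      omega
    · exact fun x h1 h2 => hm' x (by omega) (by omega)

end NCPerm

/-! ### Non-crossing partitions correspond to non-crossing permutations. -/

namespace NCPerm

open Equiv Equiv.Perm Finset

/-- The open interval under an ascending arc is mapped into itself; being finite, it is a union of
orbits. -/
theorem IsNC.lt_and_lt_of_sameCycle {a b : ℕ} {σ : Perm ℕ} (h : IsNC a b σ) {x y z : ℕ}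
    (hxy : x < y) (hy : y < σ x) (hyz : σ.SameCycle y z) : x < z ∧ z < σ x := by
  have hiff := apply_mem_iff_of_mapsTo (σ := σ) (S := Ioo x (σ x)) fun u hu => by
    rw [mem_Ioo] at hu ⊢
    exact h.nested x u hu.1 hu.2
  have := rel_of_sameCycle (r := fun u v => u ∈ Ioo x (σ x) ↔ v ∈ Ioo x (σ x))
    ⟨fun _ => .rfl, .symm, .trans⟩ (fun u => (hiff u).symm) hyz
  simpa only [mem_Ioo] using this.1 (mem_Ioo.2 ⟨hxy, hy⟩)

theorem IsNC.not_lt_of_sameCycle {a b : ℕ} {σ : Perm ℕ} (h : IsNC a b σ) {x y : ℕ}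
    (hxy : x < y) (hs : σ.SameCycle x y) : σ x ≤ y := by
  by_contra hy
  exact lt_irrefl x (h.lt_and_lt_of_sameCycle hxy (not_le.1 hy) hs.symm).1

/-- From a point of the orbit below `x` the permutation cannot jump over `x`, and `x` itself does
not go up. So the orbit points up to `x` form an invariant set, hence the whole orbit. -/
theorem IsNC.le_of_sameCycle {a b : ℕ} {σ : Perm ℕ} (h : IsNC a b σ) {x z : ℕ}
    (hx : σ x ≤ x) (hz : σ.SameCycle x z) : z ≤ x := by
  classical
  have hiff := apply_mem_iff_of_mapsTo (σ := σ)
    (S := {u ∈ range (x + 1) | σ.SameCycle x u}) fun u hu => by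
    rw [mem_filter, mem_range] at hu ⊢
    refine ⟨?_, sameCycle_apply_right.2 hu.2⟩
    rcases (Nat.lt_succ_iff.1 hu.1).lt_or_eq with hux | rfl
    · exact Nat.lt_succ_of_le (h.not_lt_of_sameCycle hux hu.2.symm)
    · omega
  have := rel_of_sameCycle (r := fun u v => u ∈ {u ∈ range (x + 1) | σ.SameCycle x u} ↔
      v ∈ {u ∈ range (x + 1) | σ.SameCycle x u})
    ⟨fun _ => .rfl, .symm, .trans⟩ (fun u => (hiff u).symm) hz
  have := this.1 (by simp [SameCycle.refl])
  rw [mem_filter, mem_range] at this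
  omega

/-- The preimage of the least orbit point does not go up either, so it is also the maximum of the
orbit and equals `x`. -/
theorem IsNC.apply_le_of_sameCycle {a b : ℕ} {σ : Perm ℕ} (h : IsNC a b σ) {x z : ℕ}
    (hx : σ x ≤ x) (hz : σ.SameCycle x z) : σ x ≤ z := by
  classical
  have hex : ∃ z, σ.SameCycle x z := ⟨x, .rfl⟩
  have hm : σ.SameCycle x (σ.symm (Nat.find hex)) :=
    sameCycle_symm_apply_right.2 (Nat.find_spec hex)
  have h1 : σ (σ.symm (Nat.find hex)) ≤ σ.symm (Nat.find hex) := by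
    rw [apply_symm_apply]
    exact Nat.find_min' hex hm
  have h2 := (h.le_of_sameCycle hx hm).antisymm (h.le_of_sameCycle h1 hm.symm)
  rw [← h2, apply_symm_apply]
  exact Nat.find_min' hex hz

/-- The image of a point is the next larger point of its orbit, or the least one if there is none;
the orbits thus determine the permutation. -/
theorem IsNC.ext_of_sameCycle {a b : ℕ} {σ τ : Perm ℕ} (hσ : IsNC a b σ) (hτ : IsNC a b τ)
    (h : ∀ x y, σ.SameCycle x y ↔ τ.SameCycle x y) : σ = τ := by
  have key : ∀ {σ τ : Perm ℕ}, IsNC a b σ → IsNC a b τ →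
      (∀ x y, σ.SameCycle x y ↔ τ.SameCycle x y) → ∀ x, σ x ≤ τ x := by
    intro σ τ hσ hτ h x
    have h1 : σ.SameCycle x (τ x) := (h _ _).2 (sameCycle_apply_right.2 .rfl)
    have h2 : τ.SameCycle x (σ x) := (h _ _).1 (sameCycle_apply_right.2 .rfl)
    by_cases hx : σ x ≤ x
    · exact hσ.apply_le_of_sameCycle hx h1
    · by_cases hx' : τ x ≤ x
      · exact hτ.le_of_sameCycle hx' h2 |>.not_gt (not_le.1 hx) |>.elim
      · exact hσ.not_lt_of_sameCycle (not_le.1 hx') h1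
  ext x
  exact (key hσ hτ h x).antisymm (key hτ hσ (fun x y => (h x y).symm) x)

/-- Take the last point `u` before `y` in the orbit of `x`. If `y` were in another orbit, the arc
from `u` would pass over `y` and so enclose `w`, yet it ends at `z` or earlier. -/
theorem IsNC.sameCycle_of_crossing {a b : ℕ} {σ : Perm ℕ} (h : IsNC a b σ) {x y z w : ℕ}
    (hxy : x < y) (hyz : y < z) (hzw : z < w) (hxz : σ.SameCycle x z) (hyw : σ.SameCycle y w) :
    σ.SameCycle x y := by
  classical
  by_contra hn
  have hne : ({u ∈ range y | σ.SameCycle x u}).Nonempty := ⟨x, by simp [hxy, SameCycle.refl]⟩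
  obtain ⟨u, hu, hmax⟩ := Finset.exists_max_image _ id hne
  rw [mem_filter, mem_range] at hu
  have h1 : u < σ u := by
    by_contra h1
    have := h.le_of_sameCycle (not_lt.1 h1) (hu.2.symm.trans hxz)
    omega
  have hxσ : σ.SameCycle x (σ u) := sameCycle_apply_right.2 hu.2
  have h2 : y < σ u := by
    by_contra h2
    rcases (not_lt.1 h2).lt_or_eq with h2 | h2
    · have := hmax (σ u) (by rw [mem_filter, mem_range]; exact ⟨h2, hxσ⟩)
      simp only [id] at this
      omega
    · exact hn (h2 ▸ hxσ)
  have h3 := h.lt_and_lt_of_sameCycle hu.1 h2 hyw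
  have h4 := h.not_lt_of_sameCycle (hu.1.trans hyz) (hu.2.symm.trans hxz)
  omega

variable {n : ℕ}

/-- A permutation of `Fin n` viewed as a permutation of `ℕ`. -/
noncomputable def toPermNat (τ : Perm (Fin n)) : Perm ℕ := viaEmbeddingHom Fin.valEmbedding τ

theorem toPermNat_apply (τ : Perm (Fin n)) (i : Fin n) : toPermNat τ i = τ i :=
  viaEmbedding_apply τ Fin.valEmbedding i

theorem toPermNat_apply_of_le (τ : Perm (Fin n)) {x : ℕ} (h : n ≤ x) : toPermNat τ x = x :=
  viaEmbedding_apply_of_notMem τ Fin.valEmbedding x fun ⟨i, hi⟩ => by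
    have := i.2
    change (i : ℕ) = x at hi
    omega

theorem toPermNat_sameCycle (τ : Perm (Fin n)) (i j : Fin n) :
    (toPermNat τ).SameCycle i j ↔ τ.SameCycle i j := by
  refine exists_congr fun k => ?_
  rw [toPermNat, ← map_zpow, ← toPermNat, toPermNat_apply, Fin.val_inj]

theorem exists_toPermNat_eq {σ : Perm ℕ} (h : ∀ x ∉ Ico 0 n, σ x = x) :
    ∃ τ : Perm (Fin n), toPermNat τ = σ := by
  have hm := apply_mem_iff h
  simp only [mem_Ico, zero_le, true_and] at hm h
  refine ⟨⟨fun i => ⟨σ i, (hm i).2 i.2⟩, fun i => ⟨σ.symm i, ?_⟩, fun i => ?_, fun i => ?_⟩, ?_⟩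
  · rw [← hm, apply_symm_apply]
    exact i.2
  · simp
  · simp
  · ext x
    by_cases hx : x < n
    · exact toPermNat_apply _ ⟨x, hx⟩
    · rw [toPermNat_apply_of_le _ (not_lt.1 hx), h x hx]

theorem toPermNat_finRotate (n : ℕ) : toPermNat (finRotate n) = cyc 0 n := by
  ext x
  by_cases hx : x < n
  · obtain ⟨k, rfl⟩ : ∃ k, n = k + 1 := ⟨n - 1, by omega⟩
    refine (toPermNat_apply _ ⟨x, hx⟩).trans ?_
    rw [coe_finRotate, cyc_apply]
    simp only [Fin.ext_iff, Fin.val_last]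
    split_ifs <;> omega
  · rw [toPermNat_apply_of_le _ (not_lt.1 hx), cyc_apply_of_notMem (by simpa using hx)]

variable {R : Type*} [CommRing R]

theorem prod_parts_eq_weight (f : ℕ → R) (P : Finpartition (univ : Finset (Fin n)))
    (τ : Perm (Fin n)) (h : ∀ i j, j ∈ P.part i ↔ τ.SameCycle i j) :
    ∏ A ∈ P.parts, f A.card = weight f (fun _ => 1) (Ico 0 n) (toPermNat τ) := by
  have hmap : ∀ i : Fin n, (P.part i).map Fin.valEmbedding = orbit (toPermNat τ) (Ico 0 n) i := by
    intro i
    ext x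
    rw [mem_orbit, mem_map, mem_Ico]
    constructor
    · rintro ⟨j, hj, rfl⟩
      exact ⟨⟨zero_le, j.2⟩, (toPermNat_sameCycle τ i j).2 ((h i j).1 hj)⟩
    · rintro ⟨⟨-, hx⟩, hs⟩
      exact ⟨⟨x, hx⟩, (h _ _).2 ((toPermNat_sameCycle τ i ⟨x, hx⟩).1 hs), rfl⟩
  have horb : orbits (toPermNat τ) (Ico 0 n) = P.parts.map (mapEmbedding Fin.valEmbedding).toEmbedding := by
    ext B
    rw [mem_orbits, mem_map]
    constructor
    · rintro ⟨x, hx, rfl⟩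
      exact ⟨P.part ⟨x, (mem_Ico.1 hx).2⟩, P.part_mem.2 (mem_univ _), hmap ⟨x, (mem_Ico.1 hx).2⟩⟩
    · rintro ⟨A, hA, rfl⟩
      obtain ⟨i, hi⟩ := P.nonempty_of_mem_parts hA
      refine ⟨i, by simp, ?_⟩
      rw [← hmap, P.part_eq_of_mem hA hi]
      rfl
  rw [weight, horb, prod_map]
  refine prod_congr rfl fun A _ => ?_
  rw [← card_eq_sum_ones]
  congr 1
  exact (card_map _).symm

theorem blockCycle_le_of_lt {B : Finset (Fin n)} {i k : Fin n} (hi : i ∈ B) (hk : k ∈ B)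
    (hik : i < k) : NC.blockCycle B i ≤ k := by
  have hsort := B.sortedLT_sort
  obtain ⟨p, hp, rfl⟩ := List.getElem_of_mem ((mem_sort (· ≤ ·)).2 hi)
  obtain ⟨q, hq, rfl⟩ := List.getElem_of_mem ((mem_sort (· ≤ ·)).2 hk)
  have hpq : p < q := (hsort.getElem_lt_getElem_iff (hi := hp) (hj := hq)).1 hik
  rw [NC.blockCycle, List.formPerm_apply_lt_getElem _ (sort_nodup _ _) p (by omega)]
  exact (hsort.getElem_le_getElem_iff (hi := by omega) (hj := hq)).2 hpq

theorem mem_part_iff_sameCycle (π : Finpartition (univ : Finset (Fin n))) (i j : Fin n) :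
    j ∈ π.part i ↔ (NC.perm π).SameCycle i j := by
  constructor
  · intro hj
    have hc := (sort_nodup (π.part i) (· ≤ ·)).isCycleOn_formPerm
    have hs := hc.2 (show i ∈ {a | a ∈ (π.part i).sort (· ≤ ·)} by simp) (by simpa using hj)
    have := rel_of_sameCycle (σ := NC.blockCycle (π.part i))
      (r := fun u v => (u ∈ π.part i ↔ v ∈ π.part i) ∧
        (u ∈ π.part i → (NC.perm π).SameCycle u v))
      ⟨fun _ => ⟨.rfl, fun _ => .rfl⟩, fun h => ⟨h.1.symm, fun h' => (h.2 (h.1.2 h')).symm⟩,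
        fun h h' => ⟨h.1.trans h'.1, fun h1 => (h.2 h1).trans (h'.2 (h.1.1 h1))⟩⟩
      (fun u => ⟨NC.blockCycle_mem.symm, fun hu => ?_⟩) hs
    · exact this.2 (π.mem_part (mem_univ _))
    · have : NC.blockCycle (π.part i) u = NC.perm π u := by
        change _ = NC.blockCycle (π.part u) u
        rw [π.part_eq_of_mem (π.part_mem.2 (mem_univ _)) hu]
      rw [this, sameCycle_apply_right]
  · intro h
    have := rel_of_sameCycle (r := fun u v => π.part u = π.part v)
      ⟨fun _ => .refl _, .symm, .trans⟩ (fun u => (NC.part_blockCycle π u).symm) h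
    rw [this]
    exact π.mem_part (mem_univ _)

/-- An ascending arc joins neighbours of a block, so a point strictly under it lies in another
block, and an image outside the arc would make the two blocks cross. -/
theorem isNC_toPermNat_perm {π : Finpartition (univ : Finset (Fin n))} (h : IsNonCrossing π) :
    IsNC 0 n (toPermNat (NC.perm π)) := by
  refine ⟨fun x hx => toPermNat_apply_of_le _ (by simpa using hx), fun x y hxy hy => ?_⟩
  by_cases hx : x < n
  swap
  · rw [toPermNat_apply_of_le _ (not_lt.1 hx)] at hy
    omega
  obtain ⟨i, rfl⟩ : ∃ i : Fin n, (i : ℕ) = x := ⟨⟨x, hx⟩, rfl⟩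
  rw [toPermNat_apply] at hy ⊢
  obtain ⟨j, rfl⟩ : ∃ j : Fin n, (j : ℕ) = y := ⟨⟨y, hy.trans (Fin.is_lt _)⟩, rfl⟩
  rw [toPermNat_apply]
  simp only [Fin.val_fin_lt] at hxy hy ⊢
  have hpi : ∀ i, NC.perm π i ∈ π.part i := fun i =>
    (mem_part_iff_sameCycle π _ _).2 (sameCycle_apply_right.2 .rfl)
  have hself : ∀ i, i ∈ π.part i := fun i => π.mem_part (mem_univ i)
  have heq : ∀ {i j}, j ∈ π.part i → π.part i = π.part j := fun hj =>
    (π.part_eq_of_mem (π.part_mem.2 (mem_univ _)) hj).symm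
  have hij : j ∉ π.part i := fun hj =>
    (blockCycle_le_of_lt (hself i) hj hxy).not_gt hy
  have hji : ∀ k ∈ π.part i, NC.perm π j ≠ k := fun k hk hjk => by
    subst hjk
    refine hij ?_
    rw [heq hk, ← heq (hpi j)]
    exact hself j
  constructor
  · by_contra hlt
    have hlt := lt_of_le_of_ne (not_lt.1 hlt) (hji i (hself i))
    have h1 := h _ i j _ hlt hxy hy (by rw [← heq (hpi j)]; exact hself j) (hpi i)
    rw [← heq (hpi j)] at h1
    refine hij ?_
    rw [← heq h1]
    exact hself j
  · by_contra hlt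
    have hlt := lt_of_le_of_ne (not_lt.1 hlt) (hji _ (hpi i)).symm
    exact hij (h i j _ _ hxy hy hlt (hpi i) (hpi j))

/-- For surjectivity, the orbit partition of a non-crossing permutation is non-crossing, and its
associated permutation has the same orbits, hence is the given one. -/
theorem sum_NC_eq_sum_ncSet {M : Type*} [AddCommMonoid M] (n : ℕ) (F : Perm ℕ → M) :
    ∑ π ∈ NC n, F (toPermNat (NC.perm π)) = ∑ σ ∈ ncSet 0 n, F σ := by
  classical
  refine sum_bij (fun π _ => toPermNat (NC.perm π)) (fun π hπ => ?_) (fun π _ π' _ he => ?_)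
    (fun σ hσ => ?_) fun _ _ => rfl
  · exact mem_ncSet.2 (isNC_toPermNat_perm (mem_filter.1 hπ).2)
  · have he := viaEmbeddingHom_injective Fin.valEmbedding he
    have hp : ∀ i, π.part i = π'.part i := fun i => by
      ext j
      rw [mem_part_iff_sameCycle, mem_part_iff_sameCycle, he]
    refine Finpartition.ext (Finset.ext fun A => ?_)
    constructor
    · intro hA
      obtain ⟨i, hi⟩ := π.nonempty_of_mem_parts hA
      rw [← π.part_eq_of_mem hA hi, hp]
      exact π'.part_mem.2 (mem_univ _)
    · intro hA
      obtain ⟨i, hi⟩ := π'.nonempty_of_mem_parts hA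
      rw [← π'.part_eq_of_mem hA hi, ← hp]
      exact π.part_mem.2 (mem_univ _)
  · rw [mem_ncSet] at hσ
    obtain ⟨τ, rfl⟩ := exists_toPermNat_eq hσ.apply_eq
    let π := Finpartition.ofSetoid (SameCycle.setoid τ)
    have hπ : ∀ i j, j ∈ π.part i ↔ τ.SameCycle i j := fun i j =>
      Finpartition.mem_part_ofSetoid_iff_rel
    have hnc : IsNonCrossing π := fun a b c d hab hbc hcd hc hd => by
      rw [hπ, ← toPermNat_sameCycle] at hc hd ⊢
      exact hσ.sameCycle_of_crossing hab hbc hcd hc hd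
    refine ⟨π, mem_filter.2 ⟨mem_univ _, hnc⟩, ?_⟩
    refine (isNC_toPermNat_perm hnc).ext_of_sameCycle hσ fun x y => ?_
    by_cases hx : x < n
    · by_cases hy : y < n
      · refine (toPermNat_sameCycle _ ⟨x, hx⟩ ⟨y, hy⟩).trans ?_
        rw [← mem_part_iff_sameCycle, hπ]
        exact (toPermNat_sameCycle _ ⟨x, hx⟩ ⟨y, hy⟩).symm
      · have h1 : ∀ τ : Perm (Fin n), ¬ (toPermNat τ).SameCycle x y := fun τ hs => by
          have := hs.eq_of_right (toPermNat_apply_of_le τ (not_lt.1 hy))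
          omega
        exact iff_of_false (h1 _) (h1 _)
    · have h1 : ∀ τ : Perm (Fin n), (toPermNat τ).SameCycle x y ↔ x = y := fun τ =>
        ⟨fun hs => hs.eq_of_left (toPermNat_apply_of_le τ (not_lt.1 hx)), fun h => h ▸ .rfl⟩
      rw [h1, h1]

end NCPerm

theorem NC.mem_part_kreweras {n : ℕ} (π : Finpartition (Finset.univ : Finset (Fin n)))
    (i j : Fin n) : j ∈ (kreweras π).part i ↔ ((perm π)⁻¹ * finRotate n).SameCycle i j :=
  letI : DecidableRel (Equiv.Perm.SameCycle.setoid ((perm π)⁻¹ * finRotate n)) :=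
    inferInstanceAs (DecidableRel (Equiv.Perm.SameCycle ((perm π)⁻¹ * finRotate n)))
  Finpartition.mem_part_ofSetoid_iff_rel

open NCPerm in
theorem NC.sum_prod_mul_prod_kreweras {R : Type*} [CommRing R] (f g : ℕ → R) (n : ℕ) :
    ∑ π ∈ NC (n + 1), (∏ A ∈ π.parts, f A.card) * ∏ B ∈ (kreweras π).parts, g B.card =
      krewerasSum f g (n + 1) 0 0 := by
  rw [← pairSum_eq_krewerasSum f g n 0 0 0 (fun _ => 1) (fun _ => 1) rfl (fun _ _ _ => rfl) rfl
    (fun _ _ _ => rfl), zero_add, pairSum, ← sum_NC_eq_sum_ncSet]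
  refine Finset.sum_congr rfl fun π _ => ?_
  rw [prod_parts_eq_weight f π _ (mem_part_iff_sameCycle π),
    prod_parts_eq_weight g _ _ (mem_part_kreweras π)]
  congr 1
  -- The complement is defined by `(perm π)⁻¹ * finRotate n`, whereas `pairSum` uses the inverse of
  -- this permutation; both have the same orbits.
  rw [← weight_inv, toPermNat, ← map_inv, mul_inv_rev, inv_inv, map_mul, map_inv]
  rw [← toPermNat, toPermNat_finRotate, toPermNat]

/-! ### Generating functions and functional equations. -/

namespace NCPerm

open PowerSeries
open Finset hiding mk

variable {R : Type*} [CommRing R]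

theorem subst_mk_eq {w : R⟦X⟧} (hw : HasSubst w) (c : ℕ → R) :
    (mk c).subst w = C (c 0) + w * (mk fun i => c (1 + i)).subst w := by
  have h : mk c = C (c 0) + X * mk fun i => c (1 + i) := by
    ext n
    cases n with
    | zero => simp
    | succ n => simp [coeff_succ_X_mul, coeff_succ_C, add_comm]
  conv_lhs => rw [h]
  rw [subst_add hw, subst_mul hw, subst_X hw, subst_C]
  rfl

/-- Unrolling the recursion gives `u` times the sum of `c (k + i) * w ^ i`. The remainder after `n`
steps is divisible by `X ^ n`, because `X` divides `w`. -/
theorem eq_mul_subst_of_rec {w : R⟦X⟧} (hw : X ∣ w) (c : ℕ → R) (u : R⟦X⟧) (A : ℕ → R⟦X⟧)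
    (h : ∀ k, A k = C (c k) * u + w * A (k + 1)) (k : ℕ) :
    A k = u * (mk fun i => c (k + i)).subst w := by
  have hs : HasSubst w := HasSubst.of_constantCoeff_zero' (X_dvd_iff.1 hw)
  have hdvd : ∀ n k, X ^ n ∣ A k - u * (mk fun i => c (k + i)).subst w := by
    intro n
    induction n with
    | zero => simp
    | succ n ih =>
      intro k
      have hk : A k - u * (mk fun i => c (k + i)).subst w =
          w * (A (k + 1) - u * (mk fun i => c (k + 1 + i)).subst w) := by
        rw [subst_mk_eq hs, h k]
        simp only [add_zero, add_assoc]
        ring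
      rw [hk, pow_succ']
      exact mul_dvd_mul hw (ih (k + 1))
  rw [← sub_eq_zero]
  ext n
  exact X_pow_dvd_iff.1 (hdvd (n + 1) k) n n.lt_succ_self

/-- The generating function of the sums `krewerasSum f g n 0 l`. -/
noncomputable def genFun (f g : ℕ → R) (l : ℕ) : R⟦X⟧ := mk fun n => krewerasSum f g n 0 l

/-- The generating function of the sums `krewerasSum f g (n + 1) k l`. -/
noncomputable def shiftGenFun (f g : ℕ → R) (k l : ℕ) : R⟦X⟧ :=
  mk fun n => krewerasSum f g (n + 1) k l

theorem genFun_eq (f g : ℕ → R) (l : ℕ) :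
    genFun f g l = C (g l) + X * shiftGenFun f g 0 l := by
  ext n
  cases n with
  | zero => simp [genFun, krewerasSum]
  | succ n => simp [genFun, shiftGenFun, coeff_succ_X_mul, coeff_succ_C]

theorem shiftGenFun_eq (f g : ℕ → R) (k l : ℕ) :
    shiftGenFun f g k l = C (f (k + 1)) * genFun f g (l + 1) +
      X * genFun f g 1 * shiftGenFun f g (k + 1) l := by
  ext n
  rw [shiftGenFun, coeff_mk, krewerasSum, map_add, coeff_C_mul, genFun, coeff_mk, mul_assoc]
  congr 1
  cases n with
  | zero => simp
  | succ n =>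
    rw [coeff_succ_X_mul, coeff_mul, Nat.sum_antidiagonal_eq_sum_range_succ_mk,
      Fin.sum_univ_eq_sum_range
        (fun j => krewerasSum f g j 0 1 * krewerasSum f g (n + 1 - j) (k + 1) l)]
    refine sum_congr rfl fun j hj => ?_
    rw [genFun, shiftGenFun, coeff_mk, coeff_mk, Nat.sub_add_comm (by simpa using hj)]

/-- This solves the recursion in `k`: the `i`-th term of the substituted series accounts for a first
block with `i + 1` elements. -/
theorem shiftGenFun_zero (f g : ℕ → R) (l : ℕ) : shiftGenFun f g 0 l =
    genFun f g (l + 1) * (mk fun i => f (1 + i)).subst (X * genFun f g 1) := by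
  have := eq_mul_subst_of_rec (dvd_mul_right X _) (fun k => f (k + 1)) (genFun f g (l + 1))
    (fun k => shiftGenFun f g k l) (fun k => shiftGenFun_eq f g k l) 0
  simpa only [zero_add, add_comm 1] using this

theorem genFun_eq_subst (f g : ℕ → R) (l : ℕ) : genFun f g l = (mk fun i => g (l + i)).subst
    (X * (mk fun i => f (1 + i)).subst (X * genFun f g 1) : R⟦X⟧) := by
  have := eq_mul_subst_of_rec (dvd_mul_right X _) g 1 (genFun f g) (fun l => by
    rw [mul_one, mul_assoc, mul_comm _ (genFun f g (l + 1)), ← shiftGenFun_zero, ← genFun_eq]) l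
  rwa [one_mul] at this

theorem hasSubst_X_mul (a : R⟦X⟧) : HasSubst (X * a) :=
  HasSubst.of_constantCoeff_zero' (X_dvd_iff.1 (dvd_mul_right X a))

theorem genFun_one_eq_subst {e : ℕ → R} (he : e 0 = 1) :
    genFun e 1 0 = (mk e).subst (X * genFun e 1 0) := by
  -- When `g = 1`, the sizes of the complement blocks are invisible and the parameter `l` has no
  -- effect.
  have h01 : genFun e 1 1 = genFun e 1 0 := by
    rw [genFun_eq_subst e 1 1, genFun_eq_subst e 1 0]
    rfl
  rw [subst_mk_eq (hasSubst_X_mul _), he]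
  conv_lhs => rw [genFun_eq, shiftGenFun_zero, zero_add, h01]
  rw [mul_assoc]
  rfl

/-- With U = `genFun f g 1` and L = `shiftGenFun f g 0 0`, one has L = U F(XU) and U = G(X F(XU)).
Substituting XU into the equation of F and X F(XU) into that of G produces the argument XL both
times, so L is the product of E'(XL) and E(XL). -/
theorem shiftGenFun_eq_subst {f g : ℕ → R} {E E' : R⟦X⟧}
    (hf : (mk fun i => f (1 + i)) = E.subst (X * mk fun i => f (1 + i)))
    (hg : (mk fun i => g (1 + i)) = E'.subst (X * mk fun i => g (1 + i))) :
    shiftGenFun f g 0 0 = (E * E').subst (X * shiftGenFun f g 0 0) := by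
  have hW := hasSubst_X_mul (genFun f g 1)
  set F : R⟦X⟧ := mk fun i => f (1 + i) with hF
  set G : R⟦X⟧ := mk fun i => g (1 + i) with hG
  have hL : shiftGenFun f g 0 0 = genFun f g 1 * F.subst (X * genFun f g 1) :=
    shiftGenFun_zero f g 0
  have hU : genFun f g 1 = G.subst (X * F.subst (X * genFun f g 1)) := genFun_eq_subst f g 1
  have hq := hasSubst_X_mul (F.subst (X * genFun f g 1))
  have h1 : F.subst (X * genFun f g 1) = E.subst (X * shiftGenFun f g 0 0) := by
    conv_lhs => rw [hf]
    rw [subst_comp_subst_apply (hasSubst_X_mul F) hW, subst_mul hW, subst_X hW, hL, mul_assoc]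
  have h2 : genFun f g 1 = E'.subst (X * shiftGenFun f g 0 0) := by
    conv_lhs => rw [hU, hg]
    rw [subst_comp_subst_apply (hasSubst_X_mul G) hq, subst_mul hq, subst_X hq, ← hU, hL,
      mul_assoc, mul_comm (subst _ _)]
  rw [subst_mul (hasSubst_X_mul _), ← h1, ← h2, mul_comm, hL]

/-- The right-hand side is an X-adic contraction: agreement of `A` and `B` modulo `X ^ n` gives
agreement of `X * A` and `X * B`, and of the substituted series, modulo `X ^ (n + 1)`. -/
theorem eq_of_eq_subst {E A B : R⟦X⟧} (hA : A = E.subst (X * A)) (hB : B = E.subst (X * B)) :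
    A = B := by
  have hdvd : ∀ n, X ^ n ∣ A - B := by
    intro n
    induction n with
    | zero => simp
    | succ n ih =>
      rw [X_pow_dvd_iff]
      intro d hd
      rw [map_sub, sub_eq_zero, hA, hB, coeff_subst' (hasSubst_X_mul A),
        coeff_subst' (hasSubst_X_mul B)]
      refine finsum_congr fun k => ?_
      congr 1
      have h1 : X ^ (n + 1) ∣ (X * A) ^ k - (X * B) ^ k := by
        refine dvd_trans ?_ (sub_dvd_pow_sub_pow _ _ k)
        rw [← mul_sub, pow_succ']
        exact mul_dvd_mul_left _ ih
      have := X_pow_dvd_iff.1 h1 d hd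
      rwa [map_sub, sub_eq_zero] at this
  rw [← sub_eq_zero]
  ext n
  exact X_pow_dvd_iff.1 (hdvd (n + 1)) n n.lt_succ_self

/-- Both sides are coefficients of solutions of one functional equation. The truncated `k - 1` is
harmless at `k = 0`, since only values at positive arguments enter the left side. -/
theorem krewerasSum_succ_eq {e e' : ℕ → R} (he : e 0 = 1) (he' : e' 0 = 1) (n : ℕ) :
    krewerasSum (fun k => krewerasSum e 1 (k - 1) 0 0) (fun k => krewerasSum e' 1 (k - 1) 0 0)
      (n + 1) 0 0 = krewerasSum (fun k => ∑ p ∈ antidiagonal k, e p.1 * e' p.2) 1 n 0 0 := by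
  have key : ∀ {e : ℕ → R}, e 0 = 1 → (mk fun i => krewerasSum e 1 (1 + i - 1) 0 0) =
      (mk e).subst (X * mk fun i => krewerasSum e 1 (1 + i - 1) 0 0) := fun {e} he => by
    simp only [add_tsub_cancel_left]
    exact genFun_one_eq_subst he
  have h1 := shiftGenFun_eq_subst (f := fun k => krewerasSum e 1 (k - 1) 0 0)
    (g := fun k => krewerasSum e' 1 (k - 1) 0 0) (key he) (key he')
  have h2 := genFun_one_eq_subst (e := fun k => ∑ p ∈ antidiagonal k, e p.1 * e' p.2)
    (by simp [he, he'])
  have h3 : mk e * mk e' = mk fun k => ∑ p ∈ antidiagonal k, e p.1 * e' p.2 := by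
    ext k
    simp [coeff_mul]
  rw [h3] at h1
  have := congrArg (coeff n) (eq_of_eq_subst h1 h2)
  rwa [shiftGenFun, genFun, coeff_mk, coeff_mk] at this

end NCPerm

/-! ### The comultiplication of `y n` and its compatibility with `Phi`. -/

theorem NC.sum_prod_eq_krewerasSum {R : Type*} [CommRing R] (e : ℕ → R) (n : ℕ) :
    ∑ π ∈ NC n, ∏ A ∈ π.parts, e A.card = NCPerm.krewerasSum e 1 n 0 0 := by
  cases n with
  | zero =>
    have h : ∀ π : Finpartition (Finset.univ : Finset (Fin 0)), π.parts = ∅ := fun π => by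
      refine Finset.eq_empty_of_forall_notMem fun A hA => ?_
      obtain ⟨i, -⟩ := π.nonempty_of_mem_parts hA
      exact i.elim0
    have hc : (NC 0).card = 1 := by decide
    rw [NCPerm.krewerasSum, Finset.sum_congr rfl fun π _ => by rw [h π, Finset.prod_empty],
      Finset.sum_const, hc, one_smul]
    rfl
  | succ n =>
    rw [← NC.sum_prod_mul_prod_kreweras]
    simp

namespace SymmFun

theorem algHom_ext {B : Type*} [Semiring B] [Algebra ℂ B] {φ ψ : SymmFun →ₐ[ℂ] B}
    (h : ∀ n, φ (e n) = ψ (e n)) : φ = ψ := by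
  have h1 : φ.comp ofE = ψ.comp ofE := MvPolynomial.algHom_ext fun i => by
    simp [ofE, h]
  ext f
  obtain ⟨p, rfl⟩ := ofE_surjective f
  exact DFunLike.congr_fun h1 p

theorem comul_e' (n : ℕ) :
    comul (e n) = ∑ p ∈ Finset.HasAntidiagonal.antidiagonal n, e p.1 ⊗ₜ[ℂ] e p.2 := by
  rw [comul_e, Finset.Nat.sum_antidiagonal_eq_sum_range_succ_mk]

theorem y_succ (n : ℕ) : y (n + 1) = NCPerm.krewerasSum e 1 n 0 0 :=
  NC.sum_prod_eq_krewerasSum e n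

theorem y_one : y 1 = 1 := by
  rw [y_succ, NCPerm.krewerasSum]
  rfl

theorem map_y {B : Type*} [CommRing B] [Algebra ℂ B] (φ : SymmFun →ₐ[ℂ] B) (n : ℕ) :
    φ (y n) = NCPerm.krewerasSum (fun k => φ (e k)) 1 (n - 1) 0 0 := by
  rw [y, ← NC.sum_prod_eq_krewerasSum, map_sum]
  simp only [map_prod]

/-- Two homomorphisms into one commutative algebra replace the tensor factors, so that the power
series identity applies; `comul_y` takes the two inclusions into the tensor square. -/
theorem map_y_of_convolution {B : Type*} [CommRing B] [Algebra ℂ B] {α β δ : SymmFun →ₐ[ℂ] B}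
    (h : ∀ k, δ (e k) = ∑ p ∈ Finset.HasAntidiagonal.antidiagonal k, α (e p.1) * β (e p.2))
    (n : ℕ) : δ (y (n + 1)) = ∑ π ∈ NC (n + 1),
      α (∏ A ∈ π.parts, y A.card) * β (∏ B ∈ (NC.kreweras π).parts, y B.card) := by
  rw [map_y, funext h, Nat.add_sub_cancel]
  refine (NCPerm.krewerasSum_succ_eq (e := fun k => α (e k)) (e' := fun k => β (e k))
    (by rw [e_zero, map_one]) (by rw [e_zero, map_one]) n).symm.trans ?_
  rw [← NC.sum_prod_mul_prod_kreweras]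
  simp only [← map_y, ← map_prod]

theorem comul_y (n : ℕ) : comul (y (n + 1)) = ∑ π ∈ NC (n + 1),
    (∏ A ∈ π.parts, y A.card) ⊗ₜ[ℂ] ∏ B ∈ (NC.kreweras π).parts, y B.card := by
  refine (map_y_of_convolution (B := SymmFun ⊗[ℂ] SymmFun)
    (α := Algebra.TensorProduct.includeLeft) (β := Algebra.TensorProduct.includeRight)
    (δ := comul) (fun k => ?_) n).trans (Finset.sum_congr rfl fun π _ => ?_)
  · rw [comul_e']
    refine Finset.sum_congr rfl fun p _ => ?_
    refine Eq.trans ?_ (Algebra.TensorProduct.tmul_mul_tmul _ _ _ _).symm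
    rw [mul_one, one_mul]
  · refine (Algebra.TensorProduct.tmul_mul_tmul _ _ _ _).trans ?_
    rw [mul_one, one_mul]

end SymmFun

theorem Phi_Y {n : ℕ} (hn : n ≠ 0) : Phi (YAlg.Y n) = SymmFun.y n := by
  by_cases h : 2 ≤ n
  · rw [YAlg.Y, dif_pos h, Phi, MvPolynomial.aeval_X]
  · obtain rfl : n = 1 := by omega
    rw [YAlg.Y, dif_neg h, map_one, SymmFun.y_one]

theorem Phi_Ypart {n : ℕ} (π : Finpartition (Finset.univ : Finset (Fin n))) :
    Phi (YAlg.Ypart π) = ∏ A ∈ π.parts, SymmFun.y A.card := by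
  rw [YAlg.Ypart, map_prod]
  exact Finset.prod_congr rfl fun A hA =>
    Phi_Y (Finset.card_ne_zero.2 (π.nonempty_of_mem_parts hA))

theorem comul_comp_Phi :
    SymmFun.comul.comp Phi = (Algebra.TensorProduct.map Phi Phi).comp YAlg.comul := by
  refine MvPolynomial.algHom_ext fun n => ?_
  obtain ⟨m, hm⟩ : ∃ m, n.1 = m + 1 := ⟨n.1 - 1, by have := n.2; omega⟩
  rw [AlgHom.comp_apply, AlgHom.comp_apply, Phi, YAlg.comul, MvPolynomial.aeval_X,
    MvPolynomial.aeval_X, ← Phi, map_sum, hm, SymmFun.comul_y]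
  refine Finset.sum_congr rfl fun π _ => ?_
  rw [Algebra.TensorProduct.map_tmul, Phi_Ypart, Phi_Ypart]

/-! ### Triangularity and the inverse of `Phi`. -/

/-- The one-block partition is the only one with a block of size `n`. Splitting it off shows that `y
(n + 1)` is `e n` plus terms in smaller `e k`, which makes `Phi` invertible. -/
theorem NC.sum_prod_eq_add {R : Type*} [CommRing R] (x : ℕ → R) {n : ℕ} (hn : n ≠ 0) :
    ∑ π ∈ NC n, ∏ A ∈ π.parts, x A.card =
      x n + ∑ π ∈ NC n with Finset.univ ∉ π.parts, ∏ A ∈ π.parts, x A.card := by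
  have : NeZero n := ⟨hn⟩
  have hne : (Finset.univ : Finset (Fin n)) ≠ ⊥ := Finset.univ_nonempty.ne_empty
  rw [← Finset.sum_filter_add_sum_filter_not (NC n) fun π => Finset.univ ∈ π.parts]
  congr 1
  have hmem : Finpartition.indiscrete hne ∈ NC n := by
    refine Finset.mem_filter.2 ⟨Finset.mem_univ _, fun a b c d _ _ _ _ _ => ?_⟩
    rw [Finpartition.part_eq_of_mem (t := Finset.univ) _ (by simp) (Finset.mem_univ a)]
    exact Finset.mem_univ b
  have hset : (NC n).filter (fun π => Finset.univ ∈ π.parts) = {Finpartition.indiscrete hne} := by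
    ext π
    rw [Finset.mem_filter, Finset.mem_singleton]
    constructor
    · rintro ⟨-, hπ⟩
      refine Finpartition.ext (Finset.ext fun A => ?_)
      rw [Finpartition.indiscrete_parts, Finset.mem_singleton]
      refine ⟨fun hA => ?_, fun hA => hA ▸ hπ⟩
      obtain ⟨i, hi⟩ := π.nonempty_of_mem_parts hA
      exact π.eq_of_mem_parts hA hπ hi (Finset.mem_univ i)
    · rintro rfl
      exact ⟨hmem, by simp⟩
  rw [hset, Finset.sum_singleton, Finpartition.indiscrete_parts, Finset.prod_singleton,
    Finset.card_univ, Fintype.card_fin]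

namespace YAlg

/-- The preimage of the elementary symmetric function `e n` under `Phi`, for `n ≥ 1`. -/
noncomputable def preE (n : ℕ) : YAlg :=
  Y (n + 1) - ∑ π ∈ NC n with Finset.univ ∉ π.parts,
    ∏ A ∈ π.parts, if _h : A.card < n then preE A.card else 0
termination_by n

theorem card_lt_of_mem_parts {n : ℕ} {π : Finpartition (Finset.univ : Finset (Fin n))}
    (hπ : Finset.univ ∉ π.parts) {A : Finset (Fin n)} (hA : A ∈ π.parts) : A.card < n := by
  have : A ≠ Finset.univ := fun h => hπ (h ▸ hA)
  simpa using (Finset.card_lt_iff_ne_univ A).2 this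

theorem preE_eq (n : ℕ) : preE n = Y (n + 1) -
    ∑ π ∈ NC n with Finset.univ ∉ π.parts, ∏ A ∈ π.parts, preE A.card := by
  rw [preE]
  congr 1
  refine Finset.sum_congr rfl fun π hπ => Finset.prod_congr rfl fun A hA => ?_
  rw [dif_pos (card_lt_of_mem_parts (Finset.mem_filter.1 hπ).2 hA)]

end YAlg

/-- The inverse of `Phi`. -/
noncomputable def PhiInv : SymmFun →ₐ[ℂ] YAlg :=
  (MvPolynomial.aeval fun n => YAlg.preE (n + 1)).comp
    (SymmFun.equivE.symm : SymmFun →ₐ[ℂ] MvPolynomial ℕ ℂ)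

theorem PhiInv_e {n : ℕ} (hn : n ≠ 0) : PhiInv (SymmFun.e n) = YAlg.preE n := by
  obtain ⟨m, rfl⟩ := Nat.exists_eq_succ_of_ne_zero hn
  change MvPolynomial.aeval _ (SymmFun.equivE.symm (SymmFun.e (m + 1))) = _
  rw [SymmFun.equivE_symm_e, MvPolynomial.aeval_X]

theorem PhiInv_Phi (a : YAlg) : PhiInv (Phi a) = a := by
  have : PhiInv.comp Phi = AlgHom.id ℂ YAlg := by
    refine MvPolynomial.algHom_ext fun n => ?_
    have hn := n.2
    rw [AlgHom.comp_apply, Phi, MvPolynomial.aeval_X, SymmFun.y, map_sum]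
    simp only [map_prod]
    rw [NC.sum_prod_eq_add (fun k => PhiInv (SymmFun.e k)) (by omega), PhiInv_e (by omega),
      YAlg.preE_eq, Finset.sum_congr rfl fun π _ => Finset.prod_congr rfl fun A hA =>
        PhiInv_e (Finset.card_ne_zero.2 (π.nonempty_of_mem_parts hA)), sub_add_cancel,
      Nat.sub_add_cancel (by omega), YAlg.Y, dif_pos hn]
    rfl
  exact DFunLike.congr_fun this a

theorem Phi_preE (n : ℕ) (hn : n ≠ 0) : Phi (YAlg.preE n) = SymmFun.e n := by
  induction n using Nat.strong_induction_on with
  | _ n ih =>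
  rw [YAlg.preE_eq, map_sub, Phi_Y (Nat.add_one_ne_zero n), map_sum, SymmFun.y, Nat.add_sub_cancel,
    NC.sum_prod_eq_add _ hn, sub_eq_iff_eq_add]
  congr 1
  refine Finset.sum_congr rfl fun π hπ => ?_
  rw [map_prod]
  exact Finset.prod_congr rfl fun A hA =>
    (ih _ (YAlg.card_lt_of_mem_parts (Finset.mem_filter.1 hπ).2 hA)
      (Finset.card_ne_zero.2 (π.nonempty_of_mem_parts hA))).symm

theorem Phi_PhiInv (f : SymmFun) : Phi (PhiInv f) = f := by
  have : Phi.comp PhiInv = AlgHom.id ℂ SymmFun := SymmFun.algHom_ext fun n => by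
    by_cases hn : n = 0
    · rw [hn, SymmFun.e_zero, map_one, map_one]
    · rw [AlgHom.comp_apply, PhiInv_e hn, Phi_preE n hn, AlgHom.id_apply]
  exact DFunLike.congr_fun this f

/-- The isomorphism `Phi` as an algebra equivalence. -/
noncomputable def PhiEquiv : YAlg ≃ₐ[ℂ] SymmFun :=
  AlgEquiv.ofAlgHom Phi PhiInv (AlgHom.ext Phi_PhiInv) (AlgHom.ext PhiInv_Phi)

/-! ### Gradings on tensor squares and polynomial algebras. -/

section TensorGrading

variable {A B : Type} [CommRing A] [Algebra ℂ A] [CommRing B] [Algebra ℂ B]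

/-- The homogeneous subspace of degree `n` of `A ⊗ A`. -/
noncomputable def tensorGrading (𝒜 : ℕ → Submodule ℂ A) (n : ℕ) : Submodule ℂ (A ⊗[ℂ] A) :=
  ⨆ i ∈ Finset.range (n + 1),
    LinearMap.range (TensorProduct.map (𝒜 i).subtype (𝒜 (n - i)).subtype)

theorem tmul_mem_tensorGrading {𝒜 : ℕ → Submodule ℂ A} {i j : ℕ} {a b : A} (ha : a ∈ 𝒜 i)
    (hb : b ∈ 𝒜 j) : a ⊗ₜ[ℂ] b ∈ tensorGrading 𝒜 (i + j) := by
  refine Submodule.mem_iSup_of_mem i (Submodule.mem_iSup_of_mem (by simp) ?_)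
  rw [Nat.add_sub_cancel_left]
  exact ⟨⟨a, ha⟩ ⊗ₜ ⟨b, hb⟩, rfl⟩

theorem tensorGrading_le {𝒜 : ℕ → Submodule ℂ A} {n : ℕ} {P : Submodule ℂ (A ⊗[ℂ] A)}
    (h : ∀ i j, i + j = n → ∀ a ∈ 𝒜 i, ∀ b ∈ 𝒜 j, a ⊗ₜ[ℂ] b ∈ P) : tensorGrading 𝒜 n ≤ P := by
  refine iSup₂_le fun i hi => ?_
  rintro _ ⟨t, rfl⟩
  rw [Finset.mem_range] at hi
  induction t using TensorProduct.induction_on with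
  | zero => rw [map_zero]; exact P.zero_mem
  | tmul a b => exact h i (n - i) (by omega) a a.2 b b.2
  | add s t hs ht => rw [map_add]; exact P.add_mem hs ht

theorem mul_mem_tensorGrading {𝒜 : ℕ → Submodule ℂ A}
    (hmul : ∀ m n : ℕ, ∀ a ∈ 𝒜 m, ∀ b ∈ 𝒜 n, a * b ∈ 𝒜 (m + n)) (m n : ℕ) :
    ∀ s ∈ tensorGrading 𝒜 m, ∀ t ∈ tensorGrading 𝒜 n, s * t ∈ tensorGrading 𝒜 (m + n) := by
  intro s hs t ht
  have h1 : ∀ i j, i + j = m → ∀ a ∈ 𝒜 i, ∀ b ∈ 𝒜 j, tensorGrading 𝒜 n ≤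
      (tensorGrading 𝒜 (m + n)).comap (LinearMap.mulLeft ℂ (a ⊗ₜ[ℂ] b)) := by
    intro i j hij a ha b hb
    refine tensorGrading_le fun k l hkl c hc d hd => ?_
    rw [Submodule.mem_comap, LinearMap.mulLeft_apply, Algebra.TensorProduct.tmul_mul_tmul,
      show m + n = (i + k) + (j + l) by omega]
    exact tmul_mem_tensorGrading (hmul _ _ _ ha _ hc) (hmul _ _ _ hb _ hd)
  have h2 : tensorGrading 𝒜 m ≤
      (tensorGrading 𝒜 (m + n)).comap (LinearMap.mulRight ℂ t) :=
    tensorGrading_le fun i j hij a ha b hb => h1 i j hij a ha b hb ht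
  exact h2 hs

theorem map_mem_tensorGrading {𝒜 : ℕ → Submodule ℂ A} {ℬ : ℕ → Submodule ℂ B} (φ : A →ₐ[ℂ] B)
    (h : ∀ n, ∀ a ∈ 𝒜 n, φ a ∈ ℬ n) {n : ℕ} {t : A ⊗[ℂ] A} (ht : t ∈ tensorGrading 𝒜 n) :
    Algebra.TensorProduct.map φ φ t ∈ tensorGrading ℬ n := by
  have : tensorGrading 𝒜 n ≤
      (tensorGrading ℬ n).comap (Algebra.TensorProduct.map φ φ).toLinearMap := by
    refine tensorGrading_le fun i j hij a ha b hb => ?_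
    rw [← hij, Submodule.mem_comap, AlgHom.toLinearMap_apply, Algebra.TensorProduct.map_tmul]
    exact tmul_mem_tensorGrading (h _ _ ha) (h _ _ hb)
  exact this ht

/-- This reduces the degree statements for `ofE`, `SymmFun.comul`, `Phi` and `PhiInv` to their
values on generators. -/
theorem aeval_mem_of_mem_weightedHomogeneousSubmodule {ι : Type*} {w : ι → ℕ} {v : ι → A}
    {𝒜 : ℕ → Submodule ℂ A} (hone : 1 ∈ 𝒜 0)
    (hmul : ∀ m n : ℕ, ∀ a ∈ 𝒜 m, ∀ b ∈ 𝒜 n, a * b ∈ 𝒜 (m + n)) (hv : ∀ i, v i ∈ 𝒜 (w i))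
    {n : ℕ} {p : MvPolynomial ι ℂ} (hp : p ∈ MvPolynomial.weightedHomogeneousSubmodule ℂ w n) :
    MvPolynomial.aeval v p ∈ 𝒜 n := by
  have hgm : SetLike.GradedMonoid 𝒜 := 
    { one_mem := hone, mul_mem := fun _ _ _ _ ha hb => hmul _ _ _ ha _ hb }
  rw [p.as_sum, map_sum]
  refine Submodule.sum_mem _ fun d hd => ?_
  rw [← hp (MvPolynomial.mem_support_iff.1 hd), MvPolynomial.aeval_monomial, ← Algebra.smul_def,
    Finsupp.weight_apply]
  exact Submodule.smul_mem _ _ (SetLike.prod_pow_mem_graded 𝒜 _ _ _ fun i _ => hv i)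

end TensorGrading

/-! ### The graded Hopf algebra of symmetric functions. -/

namespace SymmFun

open MvPowerSeries

theorem mul_mem_grading (m n : ℕ) : ∀ a ∈ grading m, ∀ b ∈ grading n, a * b ∈ grading (m + n) :=
  fun _ ha _ hb => SetLike.mul_mem_graded ha hb

theorem one_mem_grading : 1 ∈ grading 0 := SetLike.GradedOne.one_mem

/-- The homogeneous subspace of degree `n` of the polynomial algebra on the elementary symmetric
functions. -/
noncomputable abbrev eGrading (n : ℕ) : Submodule ℂ (MvPolynomial ℕ ℂ) :=
  MvPolynomial.weightedHomogeneousSubmodule ℂ (fun i : ℕ => i + 1) n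

theorem ofE_mem {n : ℕ} {p : MvPolynomial ℕ ℂ} (hp : p ∈ eGrading n) : ofE p ∈ grading n :=
  aeval_mem_of_mem_weightedHomogeneousSubmodule one_mem_grading mul_mem_grading
    (fun i => e_mem_grading (i + 1)) hp

theorem coeff_eq_zero_of_mem {n : ℕ} {f : SymmFun} (hf : f ∈ grading n) {m : ℕ →₀ ℕ}
    (hm : m.degree ≠ n) : coeff m (f : MvPowerSeries ℕ ℂ) = 0 := by
  by_contra h
  exact hm (hf m h)

/-- If `ofE p` is homogeneous of degree `n`, then the degree `n` component of `p` already maps to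
it, since the other components have images in other degrees. -/
theorem map_eGrading (n : ℕ) : (eGrading n).map ofE.toLinearMap = grading n := by
  apply le_antisymm
  · rintro _ ⟨p, hp, rfl⟩
    exact ofE_mem hp
  · intro f hf
    obtain ⟨p, rfl⟩ := ofE_surjective f
    refine ⟨MvPolynomial.weightedHomogeneousComponent _ n p,
      MvPolynomial.weightedHomogeneousComponent_mem _ p n, ?_⟩
    refine Subtype.ext (MvPowerSeries.ext fun m => ?_)
    change coeff m (ofE _ : MvPowerSeries ℕ ℂ) = coeff m (ofE p : MvPowerSeries ℕ ℂ)
    by_cases hm : m.degree = n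
    · have hp : p = ∑ᶠ k, MvPolynomial.weightedHomogeneousComponent (fun i : ℕ => i + 1) k p :=
        (MvPolynomial.finsum_weightedHomogeneousComponent _ p).symm
      have hfin := MvPolynomial.weightedHomogeneousComponent_finsupp
        (w := fun i : ℕ => i + 1) p
      let L : MvPolynomial ℕ ℂ →ₗ[ℂ] ℂ :=
        (coeff (R := ℂ) m) ∘ₗ SymmFun.val.toLinearMap ∘ₗ ofE.toLinearMap
      change L _ = L p
      conv_rhs => rw [hp]
      rw [show L _ = L.toAddMonoidHom _ from rfl, show L _ = L.toAddMonoidHom _ from rfl,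
        L.toAddMonoidHom.map_finsum hfin, finsum_eq_single _ n]
      intro k hk
      exact coeff_eq_zero_of_mem
        (ofE_mem (MvPolynomial.weightedHomogeneousComponent_mem _ p k)) (by omega)
    · rw [coeff_eq_zero_of_mem hf hm, coeff_eq_zero_of_mem
        (ofE_mem (MvPolynomial.weightedHomogeneousComponent_mem _ p n)) hm]

theorem isInternal_grading : DirectSum.IsInternal grading := by
  have h := (MvPolynomial.weightedGradedAlgebra ℂ (fun i : ℕ => i + 1)).isInternal
  rw [DirectSum.isInternal_submodule_iff_iSupIndep_and_iSup_eq_top] at h ⊢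
  have hmap : grading = fun n => Submodule.orderIsoMapComap equivE.toLinearEquiv (eGrading n) :=
    funext fun n => (map_eGrading n).symm
  rw [hmap]
  refine ⟨h.1.map_orderIso _, ?_⟩
  rw [← OrderIso.map_iSup, h.2, OrderIso.map_top]

theorem counit_eq_zero {n : ℕ} (hn : 1 ≤ n) {f : SymmFun} (hf : f ∈ grading n) : counit f = 0 :=
  coeff_eq_zero_of_mem (m := 0) hf (by rw [map_zero]; omega)

theorem counit_e (n : ℕ) : counit (e n) = if n = 0 then 1 else 0 := by
  split_ifs with h
  · rw [h, e_zero, map_one]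
  · exact counit_eq_zero (by omega) (e_mem_grading n)

/-- The images of the elementary symmetric functions under the antipode, that is, the coefficients
of the inverse of the power series `∑ e n * t ^ n`. -/
noncomputable def antipodeE (n : ℕ) : SymmFun :=
  PowerSeries.coeff n (PowerSeries.invOfUnit (PowerSeries.mk e) 1)

/-- The antipode of the Hopf algebra of symmetric functions. -/
noncomputable def antipode : SymmFun →ₐ[ℂ] SymmFun :=
  (MvPolynomial.aeval fun n => antipodeE (n + 1)).comp
    (equivE.symm : SymmFun →ₐ[ℂ] MvPolynomial ℕ ℂ)

theorem antipode_e (n : ℕ) : antipode (e n) = antipodeE n := by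
  cases n with
  | zero =>
    rw [e_zero, map_one, antipodeE, PowerSeries.coeff_zero_eq_constantCoeff_apply,
      PowerSeries.constantCoeff_invOfUnit]
    simp
  | succ n =>
    change MvPolynomial.aeval _ (equivE.symm (e (n + 1))) = _
    rw [equivE_symm_e, MvPolynomial.aeval_X]

theorem sum_e_mul_antipodeE (n : ℕ) :
    ∑ p ∈ Finset.HasAntidiagonal.antidiagonal n, e p.1 * antipodeE p.2 = if n = 0 then 1 else 0 := by
  have h := congrArg (PowerSeries.coeff n)
    (PowerSeries.mul_invOfUnit (PowerSeries.mk e) 1 (by simp [e_zero]))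
  rw [PowerSeries.coeff_mul, PowerSeries.coeff_one] at h
  simpa only [PowerSeries.coeff_mk, antipodeE] using h

/-- On `e n` both sides are the `n`-th coefficient of a product of three copies of the series of the
`e k`, one for each tensor slot; coassociativity is associativity of that product. -/
theorem coassoc : (Algebra.TensorProduct.assoc ℂ ℂ ℂ SymmFun SymmFun SymmFun).toAlgHom.comp
    ((Algebra.TensorProduct.map comul (.id ℂ SymmFun)).comp comul) =
      (Algebra.TensorProduct.map (.id ℂ SymmFun) comul).comp comul := by
  refine algHom_ext fun n => ?_
  let a : PowerSeries (SymmFun ⊗[ℂ] (SymmFun ⊗[ℂ] SymmFun)) :=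
    .mk fun k => e k ⊗ₜ[ℂ] ((1 : SymmFun) ⊗ₜ[ℂ] (1 : SymmFun))
  let b : PowerSeries (SymmFun ⊗[ℂ] (SymmFun ⊗[ℂ] SymmFun)) :=
    .mk fun k => (1 : SymmFun) ⊗ₜ[ℂ] (e k ⊗ₜ[ℂ] (1 : SymmFun))
  let c : PowerSeries (SymmFun ⊗[ℂ] (SymmFun ⊗[ℂ] SymmFun)) :=
    .mk fun k => (1 : SymmFun) ⊗ₜ[ℂ] ((1 : SymmFun) ⊗ₜ[ℂ] e k)
  have h := congrArg (PowerSeries.coeff n) (mul_assoc a b c)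
  simp only [PowerSeries.coeff_mul, a, b, c, PowerSeries.coeff_mk, Finset.sum_mul,
    Finset.mul_sum, Algebra.TensorProduct.tmul_mul_tmul, mul_one, one_mul] at h
  simp only [AlgHom.comp_apply, comul_e', map_sum, Algebra.TensorProduct.map_tmul,
    TensorProduct.sum_tmul, TensorProduct.tmul_sum, AlgHom.id_apply]
  exact h

theorem comul_mem (n : ℕ) (f : SymmFun) (hf : f ∈ grading n) :
    comul f ∈ tensorGrading grading n := by
  rw [← map_eGrading] at hf
  obtain ⟨p, hp, rfl⟩ := hf
  have h : comul.comp ofE = MvPolynomial.aeval fun i => comul (e (i + 1)) :=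
    MvPolynomial.algHom_ext fun i => by simp [ofE]
  change (comul.comp ofE) p ∈ _
  rw [h]
  refine aeval_mem_of_mem_weightedHomogeneousSubmodule (A := SymmFun ⊗[ℂ] SymmFun)
    (tmul_mem_tensorGrading one_mem_grading one_mem_grading)
    (mul_mem_tensorGrading mul_mem_grading) (fun i => ?_) hp
  rw [comul_e']
  refine Submodule.sum_mem _ fun q hq => ?_
  rw [← Finset.HasAntidiagonal.mem_antidiagonal.1 hq]
  exact tmul_mem_tensorGrading (e_mem_grading _) (e_mem_grading _)

theorem isGradedHopfAlgebra :
    IsGradedHopfAlgebra comul counit antipode.toLinearMap grading where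
  coassoc := coassoc
  rTensor_counit := by
    refine algHom_ext fun n => ?_
    rw [AlgHom.comp_apply, comul_e', map_sum, Finset.sum_eq_single (0, n)]
    · simp [counit_e]
    · rintro ⟨i, j⟩ hij hne
      rw [Finset.HasAntidiagonal.mem_antidiagonal] at hij
      have : i ≠ 0 := by
        rintro rfl
        exact hne (by rw [← hij, zero_add])
      simp [counit_e, this]
    · simp
  lTensor_counit := by
    refine algHom_ext fun n => ?_
    rw [AlgHom.comp_apply, comul_e', map_sum, Finset.sum_eq_single (n, 0)]
    · simp [counit_e]
    · rintro ⟨i, j⟩ hij hne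
      rw [Finset.HasAntidiagonal.mem_antidiagonal] at hij
      have : j ≠ 0 := by
        rintro rfl
        exact hne (by rw [← hij, add_zero])
      simp [counit_e, this]
    · simp
  mul_antipode_rTensor := by
    -- Because the algebra is commutative, multiplication and antipode are algebra homomorphisms, so
    -- the antipode axiom only needs checking on the `e n`, where it says that the two series are
    -- inverse.
    have h : (Algebra.TensorProduct.lmul' ℂ (S := SymmFun)).comp
        ((Algebra.TensorProduct.map antipode (.id ℂ SymmFun)).comp comul) =
        (Algebra.ofId ℂ SymmFun).comp counit := by
      refine algHom_ext fun n => ?_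
      rw [AlgHom.comp_apply, AlgHom.comp_apply, AlgHom.comp_apply, comul_e', map_sum, map_sum,
        counit_e]
      simp only [Algebra.TensorProduct.map_tmul, AlgHom.id_apply, antipode_e,
        Algebra.TensorProduct.lmul'_apply_tmul]
      rw [← Finset.Nat.sum_antidiagonal_swap]
      simp only [Prod.fst_swap, Prod.snd_swap, mul_comm (antipodeE _)]
      rw [sum_e_mul_antipodeE]
      split_ifs <;> simp
    exact congrArg AlgHom.toLinearMap h
  mul_antipode_lTensor := by
    have h : (Algebra.TensorProduct.lmul' ℂ (S := SymmFun)).comp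
        ((Algebra.TensorProduct.map (.id ℂ SymmFun) antipode).comp comul) =
        (Algebra.ofId ℂ SymmFun).comp counit := by
      refine algHom_ext fun n => ?_
      rw [AlgHom.comp_apply, AlgHom.comp_apply, AlgHom.comp_apply, comul_e', map_sum, map_sum,
        counit_e]
      simp only [Algebra.TensorProduct.map_tmul, AlgHom.id_apply, antipode_e,
        Algebra.TensorProduct.lmul'_apply_tmul]
      rw [sum_e_mul_antipodeE]
      split_ifs <;> simp
    exact congrArg AlgHom.toLinearMap h
  isInternal := isInternal_grading
  one_mem := one_mem_grading
  mul_mem := mul_mem_grading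
  counit_eq_zero _ hn _ ha := counit_eq_zero hn ha
  comul_mem := comul_mem

end SymmFun

/-! ### Transport of the Hopf structure. -/

section Transport

variable {A B : Type} [CommRing A] [Algebra ℂ A] [CommRing B] [Algebra ℂ B]

/-- A graded Hopf algebra structure can be transported along an isomorphism of graded algebras. -/
theorem IsGradedHopfAlgebra.of_algEquiv {ΔA : A →ₐ[ℂ] A ⊗[ℂ] A} {εA : A →ₐ[ℂ] ℂ}
    {𝒜 : ℕ → Submodule ℂ A} {ΔB : B →ₐ[ℂ] B ⊗[ℂ] B} {εB : B →ₐ[ℂ] ℂ} {SB : B →ₗ[ℂ] B}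
    {ℬ : ℕ → Submodule ℂ B} (hB : IsGradedHopfAlgebra ΔB εB SB ℬ) (φ : A ≃ₐ[ℂ] B)
    (hΔ : ∀ b, ΔA (φ.symm b) = Algebra.TensorProduct.map φ.symm.toAlgHom φ.symm.toAlgHom (ΔB b))
    (hε : ∀ b, εA (φ.symm b) = εB b) (hφ : ∀ n, ∀ a ∈ 𝒜 n, φ a ∈ ℬ n)
    (hφ' : ∀ n, ∀ b ∈ ℬ n, φ.symm b ∈ 𝒜 n) (h𝒜 : DirectSum.IsInternal 𝒜) (hone : 1 ∈ 𝒜 0)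
    (hmul : ∀ m n : ℕ, ∀ a ∈ 𝒜 m, ∀ b ∈ 𝒜 n, a * b ∈ 𝒜 (m + n)) :
    IsGradedHopfAlgebra ΔA εA (φ.symm.toLinearMap ∘ₗ SB ∘ₗ φ.toLinearMap) 𝒜 where
  coassoc := by
    ext a
    -- Each axiom at `φ.symm b` is the image under the inverse isomorphism of the axiom at `b`; the
    -- auxiliary identities are checked on pure tensors.
    obtain ⟨b, rfl⟩ := φ.symm.surjective a
    have h := DFunLike.congr_fun hB.coassoc b
    simp only [AlgHom.comp_apply] at h ⊢
    rw [hΔ]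
    have h1 : ∀ t : B ⊗[ℂ] B, (Algebra.TensorProduct.assoc ℂ ℂ ℂ A A A).toAlgHom
        (Algebra.TensorProduct.map ΔA (.id ℂ A)
          (Algebra.TensorProduct.map φ.symm.toAlgHom φ.symm.toAlgHom t)) =
        Algebra.TensorProduct.map φ.symm.toAlgHom
          (Algebra.TensorProduct.map φ.symm.toAlgHom φ.symm.toAlgHom)
          ((Algebra.TensorProduct.assoc ℂ ℂ ℂ B B B).toAlgHom
            (Algebra.TensorProduct.map ΔB (.id ℂ B) t)) := by
      intro t
      induction t using TensorProduct.induction_on with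
      | zero => simp only [map_zero]
      | add s t hs ht => simp only [map_add, hs, ht]
      | tmul x y =>
        simp only [Algebra.TensorProduct.map_tmul, AlgHom.id_apply]
        rw [show ΔA (φ.symm.toAlgHom x) = _ from hΔ x]
        induction ΔB x using TensorProduct.induction_on with
        | zero => simp only [map_zero, TensorProduct.zero_tmul]
        | add s t hs ht => simp only [map_add, TensorProduct.add_tmul, hs, ht]
        | tmul u v => rfl
    have h2 : ∀ t : B ⊗[ℂ] B, Algebra.TensorProduct.map (.id ℂ A) ΔA
          (Algebra.TensorProduct.map φ.symm.toAlgHom φ.symm.toAlgHom t) =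
        Algebra.TensorProduct.map φ.symm.toAlgHom
          (Algebra.TensorProduct.map φ.symm.toAlgHom φ.symm.toAlgHom)
            (Algebra.TensorProduct.map (.id ℂ B) ΔB t) := by
      intro t
      induction t using TensorProduct.induction_on with
      | zero => simp only [map_zero]
      | add s t hs ht => simp only [map_add, hs, ht]
      | tmul x y =>
        simp only [Algebra.TensorProduct.map_tmul, AlgHom.id_apply]
        rw [show ΔA (φ.symm.toAlgHom y) = _ from hΔ y]
    rw [h1, h2, h]
  rTensor_counit := by
    ext a
    obtain ⟨b, rfl⟩ := φ.symm.surjective a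
    have h := DFunLike.congr_fun hB.rTensor_counit b
    rw [AlgHom.comp_apply] at h ⊢
    rw [hΔ]
    have h1 : ∀ t : B ⊗[ℂ] B, Algebra.TensorProduct.map εA (.id ℂ A)
          (Algebra.TensorProduct.map φ.symm.toAlgHom φ.symm.toAlgHom t) =
        Algebra.TensorProduct.map (.id ℂ ℂ) φ.symm.toAlgHom
          (Algebra.TensorProduct.map εB (.id ℂ B) t) := by
      intro t
      induction t using TensorProduct.induction_on with
      | zero => simp only [map_zero]
      | add s t hs ht => simp only [map_add, hs, ht]
      | tmul x y =>
        simp only [Algebra.TensorProduct.map_tmul, AlgHom.id_apply]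
        rw [show εA (φ.symm.toAlgHom x) = _ from hε x]
    rw [h1, h]
    rfl
  lTensor_counit := by
    ext a
    obtain ⟨b, rfl⟩ := φ.symm.surjective a
    have h := DFunLike.congr_fun hB.lTensor_counit b
    rw [AlgHom.comp_apply] at h ⊢
    rw [hΔ]
    have h1 : ∀ t : B ⊗[ℂ] B, Algebra.TensorProduct.map (.id ℂ A) εA
          (Algebra.TensorProduct.map φ.symm.toAlgHom φ.symm.toAlgHom t) =
        Algebra.TensorProduct.map φ.symm.toAlgHom (.id ℂ ℂ)
          (Algebra.TensorProduct.map (.id ℂ B) εB t) := by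
      intro t
      induction t using TensorProduct.induction_on with
      | zero => simp only [map_zero]
      | add s t hs ht => simp only [map_add, hs, ht]
      | tmul x y =>
        simp only [Algebra.TensorProduct.map_tmul, AlgHom.id_apply]
        rw [show εA (φ.symm.toAlgHom y) = _ from hε y]
    rw [h1, h]
    rfl
  mul_antipode_rTensor := by
    ext a
    obtain ⟨b, rfl⟩ := φ.symm.surjective a
    have h := congrArg φ.symm (DFunLike.congr_fun hB.mul_antipode_rTensor b)
    simp only [LinearMap.comp_apply, AlgHom.toLinearMap_apply, Algebra.linearMap_apply] at h ⊢
    rw [hΔ, hε, ← φ.symm.commutes, ← h]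
    induction ΔB b using TensorProduct.induction_on with
    | zero => simp only [map_zero]
    | add s t hs ht => simp only [map_add, hs, ht]
    | tmul x y => simp
  mul_antipode_lTensor := by
    ext a
    obtain ⟨b, rfl⟩ := φ.symm.surjective a
    have h := congrArg φ.symm (DFunLike.congr_fun hB.mul_antipode_lTensor b)
    simp only [LinearMap.comp_apply, AlgHom.toLinearMap_apply, Algebra.linearMap_apply] at h ⊢
    rw [hΔ, hε, ← φ.symm.commutes, ← h]
    induction ΔB b using TensorProduct.induction_on with
    | zero => simp only [map_zero]
    | add s t hs ht => simp only [map_add, hs, ht]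
    | tmul x y => simp
  isInternal := h𝒜
  one_mem := hone
  mul_mem := hmul
  counit_eq_zero n hn a ha := by
    rw [← hB.counit_eq_zero n hn (φ a) (hφ n a ha), ← hε, φ.symm_apply_apply]
  comul_mem n a ha := by
    have h := map_mem_tensorGrading φ.symm.toAlgHom hφ' (hB.comul_mem n (φ a) (hφ n a ha))
    rwa [← hΔ, φ.symm_apply_apply] at h

end Transport

/-! ### Degrees of `Phi` and its inverse, and the conclusion. -/

theorem SymmFun.y_mem_grading (n : ℕ) : y n ∈ grading (n - 1) := by
  refine Submodule.sum_mem _ fun π _ => ?_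
  have h := SetLike.prod_mem_graded grading (fun A : Finset (Fin (n - 1)) => A.card)
    (fun A => e A.card) (F := π.parts) fun A _ => e_mem_grading A.card
  rwa [π.sum_card_parts, Finset.card_univ, Fintype.card_fin] at h

namespace YAlg

theorem one_mem_grading : 1 ∈ grading 0 := MvPolynomial.isWeightedHomogeneous_one ℂ _

theorem mul_mem_grading (m n : ℕ) : ∀ a ∈ grading m, ∀ b ∈ grading n, a * b ∈ grading (m + n) :=
  fun _ ha _ hb => MvPolynomial.IsWeightedHomogeneous.mul ha hb

theorem Y_mem_grading (n : ℕ) : Y n ∈ grading (n - 1) := by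
  rw [Y]
  split_ifs with h
  · exact MvPolynomial.isWeightedHomogeneous_X ℂ _ _
  · rw [show n - 1 = 0 by omega]
    exact one_mem_grading

theorem preE_mem_grading (n : ℕ) : preE n ∈ grading n := by
  induction n using Nat.strong_induction_on with
  | _ n ih =>
  rw [preE_eq]
  refine Submodule.sub_mem _ (Y_mem_grading (n + 1)) (Submodule.sum_mem _ fun π hπ => ?_)
  have hgm : SetLike.GradedMonoid grading :=
    { one_mem := one_mem_grading, mul_mem := fun _ _ _ _ ha hb => mul_mem_grading _ _ _ ha _ hb }
  have h := SetLike.prod_mem_graded grading (fun A : Finset (Fin n) => A.card)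
    (fun A => preE A.card) (F := π.parts) fun A hA =>
      ih _ (card_lt_of_mem_parts (Finset.mem_filter.1 hπ).2 hA)
  rwa [π.sum_card_parts, Finset.card_univ, Fintype.card_fin] at h

end YAlg

theorem Phi_mem_grading (n : ℕ) (a : YAlg) (ha : a ∈ YAlg.grading n) :
    Phi a ∈ SymmFun.grading n :=
  aeval_mem_of_mem_weightedHomogeneousSubmodule (w := fun k : {k : ℕ // 2 ≤ k} => k.1 - 1)
    (v := fun k => SymmFun.y k.1) SymmFun.one_mem_grading SymmFun.mul_mem_grading
    (fun k => SymmFun.y_mem_grading k.1) ha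

theorem PhiInv_mem_grading (n : ℕ) (f : SymmFun) (hf : f ∈ SymmFun.grading n) :
    PhiInv f ∈ YAlg.grading n := by
  rw [← SymmFun.map_eGrading] at hf
  obtain ⟨p, hp, rfl⟩ := hf
  have h : PhiInv.comp SymmFun.ofE = MvPolynomial.aeval fun i => YAlg.preE (i + 1) :=
    MvPolynomial.algHom_ext fun i => by simp [SymmFun.ofE, PhiInv_e]
  change (PhiInv.comp SymmFun.ofE) p ∈ _
  rw [h]
  exact aeval_mem_of_mem_weightedHomogeneousSubmodule YAlg.one_mem_grading YAlg.mul_mem_grading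
    (fun i => YAlg.preE_mem_grading (i + 1)) hp

theorem counit_comp_Phi : SymmFun.counit.comp Phi = YAlg.counit := by
  refine MvPolynomial.algHom_ext fun n => ?_
  have hn := n.2
  rw [AlgHom.comp_apply, Phi, YAlg.counit, MvPolynomial.aeval_X, MvPolynomial.aeval_X]
  exact SymmFun.counit_eq_zero (by omega) (SymmFun.y_mem_grading n.1)

theorem YAlg.isGradedHopfAlgebra : IsGradedHopfAlgebra comul counit
    (PhiEquiv.symm.toLinearMap ∘ₗ SymmFun.antipode.toLinearMap ∘ₗ PhiEquiv.toLinearMap)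
    grading := by
  refine SymmFun.isGradedHopfAlgebra.of_algEquiv PhiEquiv (fun f => ?_) (fun f => ?_)
    Phi_mem_grading PhiInv_mem_grading (MvPolynomial.weightedGradedAlgebra ℂ _).isInternal
    one_mem_grading mul_mem_grading
  -- Compatibility with `PhiInv` follows from compatibility with `Phi`, by cancelling `Phi` in both
  -- tensor factors.
  · obtain ⟨a, rfl⟩ := PhiEquiv.surjective f
    rw [AlgEquiv.symm_apply_apply,
      show SymmFun.comul (PhiEquiv a) = _ from DFunLike.congr_fun comul_comp_Phi a,
      AlgHom.comp_apply]
    induction comul a using TensorProduct.induction_on with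
    | zero => simp only [map_zero]
    | add s t hs ht => simp only [map_add, ← hs, ← ht]
    | tmul x y => exact congrArg₂ (· ⊗ₜ[ℂ] ·) (PhiInv_Phi x).symm (PhiInv_Phi y).symm
  · obtain ⟨a, rfl⟩ := PhiEquiv.surjective f
    rw [AlgEquiv.symm_apply_apply, ← counit_comp_Phi]
    rfl

theorem theorem7p5 :
    ∃ (SY : YAlg →ₗ[ℂ] YAlg) (SSym : SymmFun →ₗ[ℂ] SymmFun),
      IsGradedHopfAlgebra YAlg.comul YAlg.counit SY YAlg.grading ∧
      IsGradedHopfAlgebra SymmFun.comul SymmFun.counit SSym SymmFun.grading ∧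
      IsGradedHopfIso YAlg.comul YAlg.counit SY YAlg.grading
        SymmFun.comul SymmFun.counit SSym SymmFun.grading Phi := by
  refine ⟨_, _, YAlg.isGradedHopfAlgebra, SymmFun.isGradedHopfAlgebra, PhiEquiv.bijective,
    comul_comp_Phi, counit_comp_Phi, ?_, fun n => le_antisymm ?_ fun f hf => ?_⟩
  -- The antipode of `YAlg` was chosen as the conjugate of `SymmFun.antipode` by `Phi`, so only
  -- `Phi_PhiInv` is needed.
  · exact LinearMap.ext fun a => (Phi_PhiInv _).symm
  · rintro _ ⟨a, ha, rfl⟩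
    exact Phi_mem_grading n a ha
  · exact ⟨PhiInv f, PhiInv_mem_grading n f hf, Phi_PhiInv f⟩
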